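/- **Setting.** Let $\mathcal F$ be a class of measurable functions on an action space $\mathcal A$, let $f^*\in\mathcal F$ be unknown with $|f^*(a)|\le C$ for all $a\in\mathcal A$, and let $R>0$, $\delta\in(0,1)$. In each round $t=1,\dots,T$ the learner sees a decision set $\mathcal D_t\subseteq\mathcal A$, plays $a_t\in\mathcal D_t$, and observes $r_t=f^*(a_t)+\epsilon_t$ and $\sigma_t$, where $0\le\sigma_t<R$ and $\epsilon_t$ is $\sigma_t$-sub-Gaussian conditionally on the information $\mathcal H_t$ available before the noise of round $t$ is drawn ($a_{1:t}$, $\epsilon_{1:t-1}$, $\sigma_t$, and any further randomization): $\mathbb E[e^{c\epsilon_t}\mid\mathcal H_t]\le e^{c^2\sigma_t^2/2}$ for all $c\in\mathbb R$. Put $J=\sum_{t=1}^T\sigma_t^2$ and $\mathrm{Regret}(T)=\sum_{t=1}^T\big(\sup_{a\in\mathcal D_t}f^*(a)-f^*(a_t)\big)$. Let $\alpha=T^{-2}$, let $N_\alpha=\mathcal N(\mathcal F,T^{-2},\|\cdot\|_\infty)$ be the sup-norm covering number of $\mathcal F$ (least number of members of $\mathcal F$ whose closed $\alpha$-balls cover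 $\mathcal F$), and let $\dim_E=\dim_E(\mathcal F,T^{-2})$ be the eluder dimension: the length of the longest sequence in $\mathcal A$ for which there is an $\epsilon'\ge T^{-2}$ such that every element $a$ is $\epsilon'$-independent of its predecessors $a_1,\dots,a_n$, i.e. some $f,g\in\mathcal F$ satisfy $\big(\sum_{i\le n}(f(a_i)-g(a_i))^2\big)^{1/2}\le\epsilon'$ and $f(a)-g(a)>\epsilon'$. Assume that $N_\alpha$ is finite and $1\le\dim_E<\infty$. **Algorithm.** The threshold $\bar\sigma>0$ and the number $L$ of levels satisfy $$\bar\sigma=\frac1{\dim_E\,\log(2N_\alpha L/\delta)\,\sqrt T},\qquad L=\lceil\log_2(R/\bar\sigma)\rceil .$$ For a level $l\in\{0,\dots,L-1\}$ let $$\beta_{t,l}^2=8(2^{l+1}\bar\sigma)^2\log\frac{2N_\alpha L}\delta+4t\alpha\Big(C+\sqrt{(2^{l+1}\bar\sigma)^2\log\tfrac{4t(t+1)L}\delta}\Big).$$ In round $t$, for each level $l$, let $\Psi_{t,l}$ be the set of earlier rounds assigned to level $l$, let $\hat f_{t,l}$ be a minimizer of $\sum_{s\in\Psi_{t,l}}(f(a_s)-r_s)^2$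 over $f\in\mathcal F$, and let $\mathcal C_{t,l}=\{f\in\mathcal F:\sum_{s\in\Psi_{t,l}}(f(a_s)-\hat f_{t,l}(a_s))^2\le\beta_{t,l}^2\}$. The learner plays a maximizer $a_t$ over $\mathcal D_t$ of $a\mapsto\min_l\sup_{f\in\mathcal C_{t,l}}f(a)$ and, with $\sigma_t$, assigns round $t$ to a level $l_t$ such that $2^{l_t}\bar\sigma\le\max(\bar\sigma,\sigma_t)\le2^{l_t+1}\bar\sigma$ (ties are broken without looking at the noise of round $t$). **Claim.** For $T$ large enough, with probability at least $1-\delta$, $\mathrm{Regret}(T)=\tilde O\big(\sqrt{\dim_E\,\log N_\alpha\,J}\big)$. Here "$T$ large enough" means that $T\ge T_0$ and that the main term is, up to logarithms, not smaller than the contribution $\min(\dim_E,T)$ that does not depend on the variances. Precisely: for every $q\in\mathbb N$ there are $K>0$ and $p\in\mathbb N$, depending only on $q$, such that for all $C$, $R>0$, $\kappa>0$ there is a $T_0$, depending only on $q,C,R,\kappa$, such that in the above setting, for all $T\ge T_0$, with probability at least $1-\delta$: if $$\min(\dim_E,T)\le\kappa(\log T)^q\sqrt{\dim_E\,\log N_\alpha\,J},$$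 then $$\mathrm{Regret}(T)\le K\,\Big(\log\frac{T(1+\log N_\alpha)}\delta\Big)^{p}\sqrt{\dim_E\,\log N_\alpha\,J}.$$ -/

import Mathlib

open MeasureTheory

open scoped NNReal ENNReal

noncomputable section

namespace HeteroBandit

/-! ### Complexity of the function class -/

/-- The action `x` is `ε`-dependent, with respect to the class `F`, on the actions `b j`, `j ∈ s`
(listed with multiplicity). -/
def IsDependent {A ι : Type*} (F : Set (A → ℝ)) (ε : ℝ) (s : Finset ι) (b : ι → A) (x : A) : Prop :=
  ∀ f ∈ F, ∀ g ∈ F, Real.sqrt (∑ j ∈ s, (f (b j) - g (b j)) ^ 2) ≤ ε → f x - g x ≤ ε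

/-- `b 0, …, b (n - 1)` is a sequence in which every element is `ε`-independent of its
predecessors. -/
def IsIndependentSeq {A : Type*} (F : Set (A → ℝ)) (ε : ℝ) (n : ℕ) (b : ℕ → A) : Prop :=
  ∀ i < n, ¬ IsDependent F ε (Finset.range i) b (b i)

/-- The `ε`-eluder dimension: the length of the longest sequence of actions such that, for some
`ε' ≥ ε`, every element is `ε'`-independent of its predecessors (`⊤` if the lengths are
unbounded). -/
def eluderDim {A : Type*} (F : Set (A → ℝ)) (ε : ℝ) : ℕ∞ :=
  ⨆ n ∈ {n : ℕ | ∃ b : ℕ → A, ∃ ε' ≥ ε, IsIndependentSeq F ε' n b}, (n : ℕ∞)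

/-- The `α`-covering number of `F` in the sup-norm: the least number of members of `F` such that
every member of `F` is within `α` of one of them, uniformly over all actions. -/
def supCoveringNumber {A : Type*} (F : Set (A → ℝ)) (α : ℝ≥0) : ℕ∞ :=
  Metric.coveringNumber α (UniformFun.ofFun '' F)

/-! ### The algorithm -/

/-- The rounds before round `t` that were put into level `k`. -/
def levelData (lev : ℕ → ℕ) (t k : ℕ) : Finset ℕ :=
  (Finset.Ico 1 t).filter fun s => lev s = k

/-- `fhat` minimizes the empirical squared loss over `F` on the rounds in `S`. -/
def IsERM {A : Type*} (F : Set (A → ℝ)) (a : ℕ → A) (r : ℕ → ℝ) (S : Finset ℕ)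
    (fhat : A → ℝ) : Prop :=
  fhat ∈ F ∧ ∀ f ∈ F, ∑ s ∈ S, (fhat (a s) - r s) ^ 2 ≤ ∑ s ∈ S, (f (a s) - r s) ^ 2

/-- The confidence set of radius `β` around `fhat` on the rounds in `S`. For `S = ∅` it is `F`. -/
def confSet {A : Type*} (F : Set (A → ℝ)) (a : ℕ → A) (S : Finset ℕ) (fhat : A → ℝ) (β : ℝ) :
    Set (A → ℝ) :=
  {f | f ∈ F ∧ ∑ s ∈ S, (f (a s) - fhat (a s)) ^ 2 ≤ β ^ 2}

/-- The confidence radius used in round `t` at level `l`. -/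
def radius (C δ α σbar : ℝ) (N L t l : ℕ) : ℝ :=
  Real.sqrt (8 * (2 ^ (l + 1) * σbar) ^ 2 * Real.log (2 * N * L / δ)
    + 4 * t * α * (C + Real.sqrt ((2 ^ (l + 1) * σbar) ^ 2 * Real.log (4 * t * (t + 1) * L / δ))))

/-- The optimistic index of the action `x` in round `t`: the minimum over the levels of the largest
value at `x` of a member of the confidence set of the level. -/
def optIndex {A : Type*} (F : Set (A → ℝ)) (L : ℕ) (β : ℕ → ℕ → ℝ) (a : ℕ → A) (lev : ℕ → ℕ)
    (fhat : ℕ → ℕ → A → ℝ) (t : ℕ) (x : A) : EReal :=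
  ⨅ l : Fin L, ⨆ f ∈ confSet F a (levelData lev t l) (fhat t l) (β t l), ((f x : ℝ) : EReal)

/-- A sample path of `T` rounds of multi-level learning with empirical risk minimization: the
decision sets `D t`, the variance proxies `σ t` and the rewards `r t` are given, and the actions
`a t`, the levels `lev t` and the estimators `fhat t l` are those that the algorithm produces.
The `L` levels are numbered `0, …, L - 1`. -/
structure IsML2Path {A : Type*} (F : Set (A → ℝ)) (T L : ℕ) (σbar : ℝ) (β : ℕ → ℕ → ℝ)
    (D : ℕ → Set A) (σ r : ℕ → ℝ) (a : ℕ → A) (lev : ℕ → ℕ) (fhat : ℕ → ℕ → A → ℝ) : Prop where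
  erm : ∀ t ∈ Finset.Icc 1 T, ∀ l < L, IsERM F a r (levelData lev t l) (fhat t l)
  action_mem : ∀ t ∈ Finset.Icc 1 T, a t ∈ D t
  action_max : ∀ t ∈ Finset.Icc 1 T, ∀ x ∈ D t,
    optIndex F L β a lev fhat t x ≤ optIndex F L β a lev fhat t (a t)
  level_lt : ∀ t ∈ Finset.Icc 1 T, lev t < L
  level_lower : ∀ t ∈ Finset.Icc 1 T, 2 ^ lev t * σbar ≤ max σbar (σ t)
  level_upper : ∀ t ∈ Finset.Icc 1 T, max σbar (σ t) ≤ 2 ^ (lev t + 1) * σbar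

/-- The choice of the threshold `σbar` and of the number `L` of levels. The two depend on each
other, so they are a positive solution of a pair of equations. -/
structure IsParameterChoice (R δ : ℝ) (d N T : ℕ) (σbar : ℝ) (L : ℕ) : Prop where
  pos : 0 < σbar
  threshold : σbar = 1 / (d * Real.log (2 * N * L / δ) * Real.sqrt T)
  levels : L = ⌈Real.logb 2 (R / σbar)⌉₊

/-! ### The stochastic environment -/

/-- The actions, variance proxies and levels of round `t` are determined by the information `ℱ t`
available before the noise of round `t`, and that noise is, conditionally on `ℱ t`,
`σ t`-sub-Gaussian, with `0 ≤ σ t < R`. -/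
structure IsSubGaussianBandit {Ω A : Type*} [MeasurableSpace A] {mΩ : MeasurableSpace Ω}
    (μ : Measure Ω) (ℱ : Filtration ℕ mΩ) (T : ℕ) (R : ℝ) (a : ℕ → Ω → A) (lev : ℕ → Ω → ℕ)
    (σ ε : ℕ → Ω → ℝ) : Prop where
  measurable_action : ∀ t ∈ Finset.Icc 1 T, Measurable[ℱ t] (a t)
  measurable_level : ∀ t ∈ Finset.Icc 1 T, Measurable[ℱ t] (lev t)
  measurable_sigma : ∀ t ∈ Finset.Icc 1 T, Measurable[ℱ t] (σ t)
  measurable_noise : ∀ t ∈ Finset.Icc 1 T, Measurable[ℱ (t + 1)] (ε t)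
  sigma_nonneg : ∀ t ∈ Finset.Icc 1 T, ∀ ω, 0 ≤ σ t ω
  sigma_lt : ∀ t ∈ Finset.Icc 1 T, ∀ ω, σ t ω < R
  integrable_exp : ∀ t ∈ Finset.Icc 1 T, ∀ c : ℝ, Integrable (fun ω => Real.exp (c * ε t ω)) μ
  subGaussian : ∀ t ∈ Finset.Icc 1 T, ∀ c : ℝ,
    μ[fun ω => Real.exp (c * ε t ω) | ℱ t] ≤ᵐ[μ] fun ω => Real.exp (c ^ 2 * σ t ω ^ 2 / 2)

/-- Regret over the rounds `1, …, T` of the actions `a t ∈ D t`. -/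
def regret {A : Type*} (fstar : A → ℝ) (D : ℕ → Set A) (a : ℕ → A) (T : ℕ) : ℝ :=
  ∑ t ∈ Finset.Icc 1 T, (sSup (fstar '' D t) - fstar (a t))

/-- The total variance `J` of the rounds `1, …, T`. -/
def totalVar (σ : ℕ → ℝ) (T : ℕ) : ℝ := ∑ t ∈ Finset.Icc 1 T, σ t ^ 2

/-- The leading term `√(d · log N · J)`. -/
def leadingTerm (d N : ℕ) (J : ℝ) : ℝ := Real.sqrt (d * Real.log N * J)

/-- The logarithmic quantity whose powers are hidden by the soft-O notation. -/
def logFactor (N T : ℕ) (δ : ℝ) : ℝ := Real.log (T * (1 + Real.log N) / δ)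

end HeteroBandit

end

/-!
The confidence sets are valid with probability at least `1 - δ`. For a centre `g` of the cover and a
level with variance proxies at most `η`, the products of `exp (Δ ε / (2 η²) - Δ² / (8 η²))` over the
rounds of the level, where `Δ = g - fstar` at the action played, form a supermartingale, and the
maximal inequality `IsSubGaussianBandit.measure_exists_le` bounds all its values at once. The
empirical risk minimizer is compared with a centre near it, and the error made by this
(`sum_sq_error_le`, `discretization_error_le`) has to fit into the radius. Since only `fstar`, and
not the class, is bounded by `C`, the error can exceed the term of the radius intended for it. This
happens only if the noise is at least of order `C`, and then the excess is a small multiple of `η²`.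
It is absorbed by running the union bound with a deviation threshold that is smaller by `1 / 2` than
the logarithm in the radius, which makes the failure probability `exp (1 / 2) * δ / 2`, plus `δ / 8`
for the event that some noise variable is unusually large (`failure_probability_le`).

On this event the algorithm is optimistic, so a regret above `e` in a round of level `l` yields a
member of the confidence set of that level that exceeds `fstar` by more than `e` at the action
(`IsML2Path.exists_wide`). By the eluder dimension there are at most `d + 4 d β² / e²` such rounds
(`card_wide_le`), hence level `l` with `n` rounds contributes about `d + √(d β² n)`
(`sum_le_of_card_le`). Here `β² n` is mainly `η² n log N`, and `η² n` is at most four times the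
total variance, except at level `0`, which the choice of `σbar` makes negligible
(`IsML2Path.card_level_mul_le`). What remains is proportional to `d` and is compared with the
leading term by the hypothesis on `min d T`.

The error estimates use that `T` is large compared to powers of the logarithmic factor, that
`d < T`, and that `C` is positive. Otherwise the bound `2 * C * T` on the regret is already below
the claim (`trivial_le_leadingTerm`); if the cover has a single centre, the hypothesis on `min d T`
fails.
-/

noncomputable section

namespace HeteroBandit

/-! ### Eluder dimension and the number of large widths -/

lemma IsDependent_congr_sum {A ι κ : Type*} {F : Set (A → ℝ)} {e : ℝ} {s : Finset ι} {u : Finset κ}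
    {b : ι → A} {c : κ → A} {x : A}
    (h : ∀ φ : A → ℝ, ∑ j ∈ s, φ (b j) = ∑ j ∈ u, φ (c j)) :
    IsDependent F e s b x ↔ IsDependent F e u c x := by
  unfold IsDependent
  have : ∀ f g : A → ℝ, ∑ j ∈ s, (f (b j) - g (b j)) ^ 2 = ∑ j ∈ u, (f (c j) - g (c j)) ^ 2 :=
    fun f g => h fun y => (f y - g y) ^ 2
  simp only [this]

/-- A finite set of rounds, each of which is independent of the earlier ones in the set, can be
listed as an independent sequence. -/
lemma exists_isIndependentSeq {A : Type*} {F : Set (A → ℝ)} {e : ℝ} (a : ℕ → A) (B : Finset ℕ)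
    (hB : ∀ t ∈ B, ¬ IsDependent F e (B.filter (· < t)) a (a t)) :
    ∃ b : ℕ → A, IsIndependentSeq F e B.card b ∧
      ∀ φ : A → ℝ, ∑ j ∈ Finset.range B.card, φ (b j) = ∑ s ∈ B, φ (a s) := by
  induction B using Finset.induction_on_max with
  | empty => exact ⟨a, fun i hi => by simp at hi, by simp⟩
  | insert t B ht ih =>
    have htB : t ∉ B := fun h => lt_irrefl _ (ht t h)
    have hfil : ∀ s ∈ B, (insert t B).filter (· < s) = B.filter (· < s) := by
      intro s hs
      rw [Finset.filter_insert, if_neg (not_lt.2 (ht s hs).le)]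
    have hfilt : (insert t B).filter (· < t) = B := by
      rw [Finset.filter_insert, if_neg (lt_irrefl t), Finset.filter_true_of_mem ht]
    obtain ⟨b, hb, hsum⟩ := ih fun s hs => by
      rw [← hfil s hs]; exact hB s (Finset.mem_insert_of_mem hs)
    refine ⟨Function.update b B.card (a t), ?_, ?_⟩
    · intro i hi
      rw [Finset.card_insert_of_notMem htB] at hi
      have hcongr : ∀ φ : A → ℝ, ∑ j ∈ Finset.range i, φ (Function.update b B.card (a t) j)
          = ∑ j ∈ Finset.range i, φ (b j) := fun φ => Finset.sum_congr rfl fun j hj => by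
        rw [Function.update_of_ne]
        have := Finset.mem_range.1 hj
        omega
      rcases Nat.lt_succ_iff_lt_or_eq.1 hi with h | rfl
      · rw [Function.update_of_ne h.ne, IsDependent_congr_sum hcongr]
        exact hb i h
      · rw [Function.update_self, IsDependent_congr_sum hcongr, IsDependent_congr_sum hsum]
        have := hB t (Finset.mem_insert_self t B)
        rwa [hfilt] at this
    · intro φ
      rw [Finset.card_insert_of_notMem htB, Finset.sum_range_succ, Function.update_self,
        Finset.sum_insert htB, ← hsum φ, add_comm]
      congr 1
      refine Finset.sum_congr rfl fun j hj => ?_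
      rw [Function.update_of_ne (Finset.mem_range.1 hj).ne]

lemma card_le_of_independent {A : Type*} {F : Set (A → ℝ)} {e₀ e : ℝ} {d : ℕ}
    (hd : eluderDim F e₀ = d) (he : e₀ ≤ e) (a : ℕ → A) (B : Finset ℕ)
    (hB : ∀ t ∈ B, ¬ IsDependent F e (B.filter (· < t)) a (a t)) : B.card ≤ d := by
  obtain ⟨b, hb, -⟩ := exists_isIndependentSeq a B hB
  have : ((B.card : ℕ) : ℕ∞) ≤ eluderDim F e₀ :=
    le_iSup₂_of_le (f := fun (n : ℕ)
      (_ : n ∈ {n : ℕ | ∃ b : ℕ → A, ∃ ε' ≥ e₀, IsIndependentSeq F ε' n b}) => (n : ℕ∞))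
      B.card ⟨b, e, he, hb⟩ le_rfl
  rw [hd] at this
  exact_mod_cast this

/-- The rounds are distributed over `K` bins, each round into a bin of which it is independent. If
no bin were left for some round, the squared deviations of the witness `f` on the earlier rounds
would add up to more than `K * e ^ 2`. -/
lemma exists_binning {A : Type*} {F : Set (A → ℝ)} {e V : ℝ} {K : ℕ} (he : 0 ≤ e) (hK : 0 < K)
    (hV : V ≤ K * e ^ 2) {fstar : A → ℝ} (hstar : fstar ∈ F) (a : ℕ → A) (S : Finset ℕ)
    (hS : ∀ t ∈ S, ∃ f ∈ F, e < f (a t) - fstar (a t) ∧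
      ∑ s ∈ S.filter (· < t), (f (a s) - fstar (a s)) ^ 2 ≤ V) :
    ∃ c : ℕ → Fin K, ∀ t ∈ S,
      ¬ IsDependent F e ((S.filter fun s => c s = c t).filter (· < t)) a (a t) := by
  induction S using Finset.induction_on_max with
  | empty => exact ⟨fun _ => ⟨0, hK⟩, by simp⟩
  | insert t S ht ih =>
    have htS : t ∉ S := fun h => lt_irrefl _ (ht t h)
    have hfil : ∀ s ∈ S, (insert t S).filter (· < s) = S.filter (· < s) := by
      intro s hs
      rw [Finset.filter_insert, if_neg (not_lt.2 (ht s hs).le)]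
    have hfilt : (insert t S).filter (· < t) = S := by
      rw [Finset.filter_insert, if_neg (lt_irrefl t), Finset.filter_true_of_mem ht]
    obtain ⟨c, hc⟩ := ih fun s hs => by
      rw [← hfil s hs]; exact hS s (Finset.mem_insert_of_mem hs)
    obtain ⟨f, hf, hft, hfS⟩ := hS t (Finset.mem_insert_self t S)
    rw [hfilt] at hfS
    obtain ⟨k, hk⟩ : ∃ k : Fin K, ¬ IsDependent F e (S.filter fun s => c s = k) a (a t) := by
      by_contra! hall
      have hbin : ∀ k : Fin K,
          e ^ 2 < ∑ s ∈ S.filter (fun s => c s = k), (f (a s) - fstar (a s)) ^ 2 := by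
        intro k
        by_contra! hle
        exact absurd (hall k f hf fstar hstar
          ((Real.sqrt_le_sqrt hle).trans_eq (Real.sqrt_sq he))) (not_le.2 hft)
      have hlt : ∑ _k : Fin K, e ^ 2
          < ∑ k : Fin K, ∑ s ∈ S.filter (fun s => c s = k), (f (a s) - fstar (a s)) ^ 2 :=
        Finset.sum_lt_sum_of_nonempty ⟨⟨0, hK⟩, Finset.mem_univ _⟩ fun k _ => hbin k
      rw [Finset.sum_fiberwise, Finset.sum_const, Finset.card_univ, Fintype.card_fin,
        nsmul_eq_mul] at hlt
      linarith
    refine ⟨Function.update c t k, fun s hs => ?_⟩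
    have hcS : ∀ k', ((insert t S).filter fun s => Function.update c t k s = k').filter (· < t)
        = S.filter fun s => c s = k' := by
      intro k'
      ext s
      simp only [Finset.mem_filter, Finset.mem_insert]
      constructor
      · rintro ⟨⟨rfl | hs, h⟩, hlt⟩
        · exact absurd hlt (lt_irrefl _)
        · rw [Function.update_of_ne hlt.ne] at h
          exact ⟨hs, h⟩
      · rintro ⟨hs, h⟩
        refine ⟨⟨Or.inr hs, ?_⟩, ht s hs⟩
        rwa [Function.update_of_ne (ht s hs).ne]
    rcases Finset.mem_insert.1 hs with rfl | hs
    · rw [hcS, Function.update_self]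
      exact hk
    · have hst := ht s hs
      have : ((insert t S).filter fun u => Function.update c t k u
          = Function.update c t k s).filter (· < s)
          = (S.filter fun u => c u = c s).filter (· < s) := by
        rw [Function.update_of_ne hst.ne]
        rw [← hcS (c s)]
        ext u
        simp only [Finset.mem_filter]
        exact ⟨fun h => ⟨⟨h.1, h.2.trans hst⟩, h.2⟩, fun h => ⟨h.1.1, h.2⟩⟩
      rw [this]
      exact hc s hs

/-- Few rounds can have a confidence set that is wide at the action played: the eluder dimension
bounds the size of each of the `⌊V / e ^ 2⌋ + 1` bins. -/
lemma card_wide_le {A : Type*} {F : Set (A → ℝ)} {e₀ e V : ℝ} {d : ℕ}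
    (hd : eluderDim F e₀ = d) (hee : e₀ ≤ e) (he : 0 < e) (hV : 0 ≤ V)
    {fstar : A → ℝ} (hstar : fstar ∈ F) (a : ℕ → A) (S : Finset ℕ)
    (hS : ∀ t ∈ S, ∃ f ∈ F, e < f (a t) - fstar (a t) ∧
      ∑ s ∈ S.filter (· < t), (f (a s) - fstar (a s)) ^ 2 ≤ V) :
    (S.card : ℝ) ≤ d + d * V / e ^ 2 := by
  have he2 : 0 < e ^ 2 := by positivity
  set K : ℕ := ⌊V / e ^ 2⌋₊ + 1 with hKdef
  have hKV : V ≤ K * e ^ 2 := by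
    have := (Nat.lt_floor_add_one (V / e ^ 2)).le
    rw [div_le_iff₀ he2] at this
    rw [hKdef]; push_cast; exact this
  obtain ⟨c, hc⟩ := exists_binning he.le (Nat.succ_pos _) hKV hstar a S hS
  have hcard : S.card ≤ ∑ _k : Fin K, d := by
    rw [Finset.card_eq_sum_card_fiberwise (f := c) (t := Finset.univ)
      (fun _ _ => Finset.mem_coe.2 (Finset.mem_univ _))]
    refine Finset.sum_le_sum fun k _ => card_le_of_independent hd hee a _ fun t ht => ?_
    obtain ⟨htS, rfl⟩ := Finset.mem_filter.1 ht
    exact hc t htS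
  rw [Finset.sum_const, Finset.card_univ, Fintype.card_fin, smul_eq_mul] at hcard
  have hK : (K : ℝ) ≤ V / e ^ 2 + 1 := by
    rw [hKdef]; push_cast
    linarith [Nat.floor_le (div_nonneg hV he2.le)]
  calc (S.card : ℝ) ≤ K * d := by exact_mod_cast hcard
    _ ≤ (V / e ^ 2 + 1) * d := by gcongr
    _ = d + d * V / e ^ 2 := by ring

/-- If few of the numbers `w t` are large, their sum is small. The bound sums the estimate
`e₀ + √(B / i)` for the `(d + i)`-th largest of them over `i`. -/
lemma sum_le_of_card_le {ι : Type*} {w : ι → ℝ} {W e₀ B : ℝ} {d : ℕ} (hW : 0 ≤ W)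
    (he₀ : 0 < e₀) (hB : 0 ≤ B) (S : Finset ι) (hwW : ∀ t ∈ S, w t ≤ W)
    (hcard : ∀ e, e₀ ≤ e → ((S.filter fun t => e < w t).card : ℝ) ≤ d + B / e ^ 2) :
    ∑ t ∈ S, w t ≤ S.card * e₀ + W * d + 2 * Real.sqrt (B * S.card) := by
  classical
  have key : ∀ (n : ℕ) (S : Finset ι), S.card = n → (∀ t ∈ S, w t ≤ W) →
      (∀ e, e₀ ≤ e → ((S.filter fun t => e < w t).card : ℝ) ≤ d + B / e ^ 2) →
      ∑ t ∈ S, w t ≤ n * e₀ + W * min (n : ℝ) d + 2 * Real.sqrt (B * ((n - d : ℕ) : ℝ)) := by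
    intro n
    induction n with
    | zero =>
      intro S hS _ _
      rw [Finset.card_eq_zero.1 hS]
      simp
    | succ n ih =>
      intro S hS hwW hcard
      obtain ⟨m, hm, hmin⟩ := S.exists_min_image w (Finset.card_pos.1 (by omega))
      have hih := ih (S.erase m) (by rw [Finset.card_erase_of_mem hm, hS]; rfl)
        (fun t ht => hwW t (Finset.mem_of_mem_erase ht)) fun e he => by
          refine le_trans ?_ (hcard e he)
          exact_mod_cast Finset.card_le_card
            (Finset.filter_subset_filter _ (Finset.erase_subset _ _))
      rw [← Finset.add_sum_erase S w hm]
      rcases lt_or_ge n d with hnd | hnd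
      · have h1 : (n + 1 - d : ℕ) = 0 := by omega
        have h2 : (n - d : ℕ) = 0 := by omega
        have h3 : min (((n + 1 : ℕ)) : ℝ) (d : ℝ) = n + 1 := by
          rw [min_eq_left (by exact_mod_cast hnd)]; push_cast; ring
        have h4 : min (n : ℝ) (d : ℝ) = n := min_eq_left (by exact_mod_cast hnd.le)
        rw [h1, h3]
        rw [h2, h4] at hih
        have := hwW m hm
        push_cast at hih ⊢
        nlinarith
      · have h3 : min (((n + 1 : ℕ)) : ℝ) (d : ℝ) = d := min_eq_right (by exact_mod_cast (by omega))
        have h4 : min (n : ℝ) (d : ℝ) = d := min_eq_right (by exact_mod_cast hnd)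
        rw [h3]
        rw [h4] at hih
        obtain ⟨i, rfl⟩ := Nat.exists_eq_add_of_le hnd
        have h1 : (d + i + 1 - d : ℕ) = i + 1 := by omega
        have h2 : (d + i - d : ℕ) = i := by omega
        rw [h1]
        rw [h2] at hih
        have hi : (0 : ℝ) < i + 1 := by positivity
        -- All `d + i + 1` values are at least `w m`, which bounds `w m`.
        have hwm : w m ≤ e₀ + Real.sqrt (B / (i + 1)) := by
          by_contra! hlt
          have hs0 := Real.sqrt_nonneg (B / (i + 1))
          set e := (w m + (e₀ + Real.sqrt (B / (i + 1)))) / 2 with hedef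
          have he1 : e₀ + Real.sqrt (B / (i + 1)) < e := by rw [hedef]; linarith
          have he2 : e < w m := by rw [hedef]; linarith
          have hc := hcard e (by linarith)
          rw [Finset.filter_true_of_mem (fun t ht => he2.trans_le (hmin t ht)), hS] at hc
          push_cast at hc
          have hepos : 0 < e := by linarith
          have h5 : (i : ℝ) + 1 ≤ B / e ^ 2 := by linarith
          rw [le_div_iff₀ (by positivity)] at h5
          have h6 : B / (i + 1) < e ^ 2 := (Real.sqrt_lt' hepos).1 (by linarith)
          rw [div_lt_iff₀ hi] at h6
          linarith
        have hstep : Real.sqrt (B / (i + 1)) + 2 * Real.sqrt (B * (i : ℝ))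
            ≤ 2 * Real.sqrt (B * ((i : ℝ) + 1)) := by
          rw [Real.sqrt_div hB, Real.sqrt_mul hB, Real.sqrt_mul hB]
          have hx := Real.sq_sqrt hi.le
          have hy := Real.sq_sqrt (Nat.cast_nonneg (α := ℝ) i)
          have hx0 := Real.sqrt_pos.2 hi
          have hb0 := Real.sqrt_nonneg B
          set x := Real.sqrt ((i : ℝ) + 1)
          set y := Real.sqrt (i : ℝ)
          have : 1 / x + 2 * y ≤ 2 * x := by
            rw [div_add' _ _ _ hx0.ne', div_le_iff₀ hx0]
            nlinarith [sq_nonneg (x - y)]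
          calc Real.sqrt B / x + 2 * (Real.sqrt B * y) = Real.sqrt B * (1 / x + 2 * y) := by ring
            _ ≤ Real.sqrt B * (2 * x) := by gcongr
            _ = _ := by ring
        push_cast at hih ⊢
        linarith
  refine (key S.card S rfl hwW hcard).trans ?_
  gcongr
  · exact min_le_right _ _
  · exact_mod_cast Nat.sub_le _ _

/-! ### Exponential supermartingales of sub-Gaussian noise -/

section SubGaussian

variable {Ω : Type*} {m mΩ : MeasurableSpace Ω} {μ : Measure Ω}

lemma lintegral_mul_exp_const_le [IsProbabilityMeasure μ] (hm : m ≤ mΩ) {X σ : Ω → ℝ} {c : ℝ}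
    (hX : Measurable X) (hσ : Measurable[m] σ)
    (hint : Integrable (fun ω => Real.exp (c * X ω)) μ)
    (hsub : μ[fun ω => Real.exp (c * X ω) | m] ≤ᵐ[μ] fun ω => Real.exp (c ^ 2 * σ ω ^ 2 / 2))
    {W : Ω → ℝ≥0∞} (hW : Measurable[m] W) :
    ∫⁻ ω, W ω * ENNReal.ofReal (Real.exp (c * X ω)) ∂μ
      ≤ ∫⁻ ω, W ω * ENNReal.ofReal (Real.exp (c ^ 2 * σ ω ^ 2 / 2)) ∂μ := by
  have hσ' : Measurable σ := hσ.mono hm le_rfl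
  have hW' : Measurable W := hW.mono hm le_rfl
  set u : Ω → ℝ≥0∞ := fun ω => ENNReal.ofReal (Real.exp (c * X ω)) with hu
  set v : Ω → ℝ≥0∞ := fun ω => ENNReal.ofReal (Real.exp (c ^ 2 * σ ω ^ 2 / 2)) with hv
  have hum : Measurable u := by fun_prop
  have hvm : Measurable v := by fun_prop
  have hle : (μ.withDensity u).trim hm ≤ (μ.withDensity v).trim hm := by
    refine Measure.le_iff.2 fun s hs => ?_
    rw [trim_measurableSet_eq hm hs, trim_measurableSet_eq hm hs,
      withDensity_apply _ (hm s hs), withDensity_apply _ (hm s hs)]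
    rw [hu, ← ofReal_integral_eq_lintegral_ofReal hint.integrableOn
      (Filter.Eventually.of_forall fun ω => (Real.exp_pos _).le),
      ← setIntegral_condExp hm hint hs]
    refine (ofReal_integral_eq_lintegral_ofReal integrable_condExp.integrableOn
      (ae_restrict_of_ae (condExp_nonneg
        (Filter.Eventually.of_forall fun ω => (Real.exp_pos _).le)))).trans_le ?_
    refine lintegral_mono_ae (ae_restrict_of_ae ?_)
    filter_upwards [hsub] with ω hω
    exact ENNReal.ofReal_le_ofReal hω
  have key : ∀ w : Ω → ℝ≥0∞, Measurable w →
      ∫⁻ ω, W ω * w ω ∂μ = ∫⁻ ω, W ω ∂((μ.withDensity w).trim hm) := by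
    intro w hw
    rw [lintegral_trim hm hW, lintegral_withDensity_eq_lintegral_mul _ hw hW']
    simp only [Pi.mul_apply, mul_comm]
  rw [key u hum, key v hvm]
  exact lintegral_mono' hle le_rfl

/-- The sub-Gaussian bound, assumed for constant exponents `c`, extends to random exponents `B` that
are known before the noise: first to simple functions, one value at a time, and then to limits of
such by Fatou's lemma. No integrability of `B` is needed. -/
lemma lintegral_mul_exp_le [IsProbabilityMeasure μ] (hm : m ≤ mΩ) {X σ : Ω → ℝ}
    (hX : Measurable X) (hσ : Measurable[m] σ)
    (hint : ∀ c : ℝ, Integrable (fun ω => Real.exp (c * X ω)) μ)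
    (hsub : ∀ c : ℝ,
      μ[fun ω => Real.exp (c * X ω) | m] ≤ᵐ[μ] fun ω => Real.exp (c ^ 2 * σ ω ^ 2 / 2))
    {B : Ω → ℝ} (hB : Measurable[m] B) {Z : Ω → ℝ≥0∞} (hZ : Measurable[m] Z) :
    ∫⁻ ω, Z ω * ENNReal.ofReal (Real.exp (B ω * X ω - B ω ^ 2 * σ ω ^ 2 / 2)) ∂μ
      ≤ ∫⁻ ω, Z ω ∂μ := by
  have hσ' : Measurable σ := hσ.mono hm le_rfl
  have hZ' : Measurable Z := hZ.mono hm le_rfl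
  have hconst : ∀ (c : ℝ) (V : Ω → ℝ≥0∞), Measurable[m] V →
      ∫⁻ ω, V ω * ENNReal.ofReal (Real.exp (c * X ω - c ^ 2 * σ ω ^ 2 / 2)) ∂μ
        ≤ ∫⁻ ω, V ω ∂μ := by
    intro c V hV
    have hE : Measurable[m] fun ω => ENNReal.ofReal (Real.exp (-(c ^ 2 * σ ω ^ 2 / 2))) :=
      ENNReal.measurable_ofReal.comp (Real.measurable_exp.comp
        (((hσ.pow_const 2).const_mul _).div_const _).neg)
    have h := lintegral_mul_exp_const_le hm hX hσ (hint c) (hsub c) (hV.mul hE)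
    refine le_trans (le_of_eq ?_) (h.trans (le_of_eq ?_))
    · refine lintegral_congr fun ω => ?_
      simp only [Pi.mul_apply]
      rw [mul_assoc, ← ENNReal.ofReal_mul (Real.exp_pos _).le, ← Real.exp_add]
      congr 3; ring
    · refine lintegral_congr fun ω => ?_
      simp only [Pi.mul_apply]
      rw [mul_assoc, ← ENNReal.ofReal_mul (Real.exp_pos _).le, ← Real.exp_add]
      simp
  have hsimple : ∀ (b : Ω → ℝ) (v : Finset ℝ), (∀ ω, b ω ∈ v) →
      (∀ c : ℝ, MeasurableSet[m] (b ⁻¹' {c})) →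
      ∫⁻ ω, Z ω * ENNReal.ofReal (Real.exp (b ω * X ω - b ω ^ 2 * σ ω ^ 2 / 2)) ∂μ
        ≤ ∫⁻ ω, Z ω ∂μ := by
    intro b v hv hset
    have hsplit : ∀ G : ℝ → Ω → ℝ≥0∞, ∀ ω,
        Z ω * G (b ω) ω = ∑ c ∈ v, (b ⁻¹' {c}).indicator Z ω * G c ω := by
      intro G ω
      rw [Finset.sum_eq_single (b ω)]
      · simp
      · intro c _ hc
        rw [Set.indicator_of_notMem (by simpa using Ne.symm hc), zero_mul]
      · intro h
        exact absurd (hv ω) h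
    have h1 := hsplit fun c ω => ENNReal.ofReal (Real.exp (c * X ω - c ^ 2 * σ ω ^ 2 / 2))
    have h2 := hsplit fun _ _ => 1
    simp only [mul_one] at h2
    simp_rw [h1]
    conv_rhs => enter [2, ω]; rw [h2]
    have hmeas : ∀ c ∈ v, Measurable fun ω => (b ⁻¹' {c}).indicator Z ω *
        ENNReal.ofReal (Real.exp (c * X ω - c ^ 2 * σ ω ^ 2 / 2)) := fun c _ =>
      (hZ'.indicator (hm _ (hset c))).mul (by fun_prop)
    rw [lintegral_finsetSum _ hmeas,
      lintegral_finsetSum _ fun c _ => hZ'.indicator (hm _ (hset c))]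
    exact Finset.sum_le_sum fun c _ => hconst c _ (hZ.indicator (hset c))
  have hBs : StronglyMeasurable[m] B := hB.stronglyMeasurable
  have hlim : ∀ ω, Filter.Tendsto (fun n => Z ω * ENNReal.ofReal
      (Real.exp (hBs.approx n ω * X ω - hBs.approx n ω ^ 2 * σ ω ^ 2 / 2))) Filter.atTop
      (nhds (Z ω * ENNReal.ofReal (Real.exp (B ω * X ω - B ω ^ 2 * σ ω ^ 2 / 2)))) := by
    intro ω
    have hb := hBs.tendsto_approx ω
    refine ENNReal.Tendsto.const_mul ?_ (Or.inl ?_)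
    · refine ENNReal.tendsto_ofReal ((Real.continuous_exp.tendsto _).comp ?_)
      exact (hb.mul_const _).sub (((hb.pow 2).mul_const _).div_const _)
    · simpa using Real.exp_pos _
  calc ∫⁻ ω, Z ω * ENNReal.ofReal (Real.exp (B ω * X ω - B ω ^ 2 * σ ω ^ 2 / 2)) ∂μ
      = ∫⁻ ω, Filter.liminf (fun n => Z ω * ENNReal.ofReal
          (Real.exp (hBs.approx n ω * X ω - hBs.approx n ω ^ 2 * σ ω ^ 2 / 2))) Filter.atTop ∂μ :=
        lintegral_congr fun ω => ((hlim ω).liminf_eq).symm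
    _ ≤ Filter.liminf (fun n => ∫⁻ ω, Z ω * ENNReal.ofReal
          (Real.exp (hBs.approx n ω * X ω - hBs.approx n ω ^ 2 * σ ω ^ 2 / 2)) ∂μ) Filter.atTop := by
        refine lintegral_liminf_le fun n => hZ'.mul ?_
        have : Measurable (hBs.approx n) := 
          (@SimpleFunc.measurable Ω ℝ m _ (hBs.approx n)).mono hm le_rfl
        fun_prop
    _ ≤ ∫⁻ ω, Z ω ∂μ := by
        refine (Filter.liminf_le_liminf (Filter.Eventually.of_forall fun n =>
          hsimple (hBs.approx n) (@SimpleFunc.range Ω ℝ m (hBs.approx n))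
            (@SimpleFunc.mem_range_self Ω ℝ m (hBs.approx n))
            (@SimpleFunc.measurableSet_fiber Ω ℝ m (hBs.approx n)))).trans ?_
        simp

end SubGaussian

section Maximal

variable {Ω A : Type*} [MeasurableSpace A] {mΩ : MeasurableSpace Ω} {μ : Measure Ω}
  {ℱ : Filtration ℕ mΩ} {T : ℕ} {R : ℝ} {a : ℕ → Ω → A} {lev : ℕ → Ω → ℕ} {σ ε : ℕ → Ω → ℝ}

lemma IsSubGaussianBandit.lintegral_mul_exp_le [IsProbabilityMeasure μ]
    (h : IsSubGaussianBandit μ ℱ T R a lev σ ε) {t : ℕ} (ht : t ∈ Finset.Icc 1 T) {B : Ω → ℝ}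
    (hB : Measurable[ℱ t] B) {Z : Ω → ℝ≥0∞} (hZ : Measurable[ℱ t] Z) :
    ∫⁻ ω, Z ω * ENNReal.ofReal (Real.exp (B ω * ε t ω - B ω ^ 2 * σ t ω ^ 2 / 2)) ∂μ
      ≤ ∫⁻ ω, Z ω ∂μ :=
  HeteroBandit.lintegral_mul_exp_le (ℱ.le t) ((h.measurable_noise t ht).mono (ℱ.le _) le_rfl)
    (h.measurable_sigma t ht) (h.integrable_exp t ht) (h.subGaussian t ht) hB hZ

/-- The logarithm of the exponential supermartingale with exponents `B t`, frozen from the first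
time on at which it reaches `x`. -/
def stoppedLog (B σ ε : ℕ → Ω → ℝ) (x : ℝ) : ℕ → Ω → ℝ
  | 0, _ => 0
  | n + 1, ω =>
    let b := if x ≤ stoppedLog B σ ε x n ω then 0 else B (n + 1) ω
    stoppedLog B σ ε x n ω + (b * ε (n + 1) ω - b ^ 2 * σ (n + 1) ω ^ 2 / 2)

lemma stoppedLog_eq_or_le (B σ ε : ℕ → Ω → ℝ) (x : ℝ) (ω : Ω) (n : ℕ) :
    x ≤ stoppedLog B σ ε x n ω ∨
      (∀ k ≤ n, ∑ s ∈ Finset.Icc 1 k, (B s ω * ε s ω - B s ω ^ 2 * σ s ω ^ 2 / 2) < x) ∧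
      stoppedLog B σ ε x n ω
        = ∑ s ∈ Finset.Icc 1 n, (B s ω * ε s ω - B s ω ^ 2 * σ s ω ^ 2 / 2) := by
  induction n with
  | zero =>
    rcases le_or_gt x 0 with hx | hx
    · exact Or.inl hx
    · refine Or.inr ⟨fun k hk => ?_, by simp [stoppedLog]⟩
      rw [Nat.le_zero.1 hk]
      simpa using hx
  | succ n ih =>
    rcases ih with h | ⟨h1, h2⟩
    · left
      simp [stoppedLog, h]
    · by_cases hx : x ≤ stoppedLog B σ ε x (n + 1) ω
      · exact Or.inl hx
      · have hn : ¬ x ≤ stoppedLog B σ ε x n ω := by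
          rw [h2]; exact not_le.2 (h1 n le_rfl)
        have h3 : stoppedLog B σ ε x (n + 1) ω
            = ∑ s ∈ Finset.Icc 1 (n + 1), (B s ω * ε s ω - B s ω ^ 2 * σ s ω ^ 2 / 2) := by
          rw [Finset.sum_Icc_succ_top (by omega), ← h2]
          simp only [stoppedLog, if_neg hn]
        refine Or.inr ⟨fun k hk => ?_, h3⟩
        rcases Nat.le_succ_iff.1 hk with hk | rfl
        · exact h1 k hk
        · rw [← h3]; exact not_le.1 hx

lemma IsSubGaussianBandit.measurable_stoppedLog (h : IsSubGaussianBandit μ ℱ T R a lev σ ε)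
    {B : ℕ → Ω → ℝ} (hB : ∀ t ∈ Finset.Icc 1 T, Measurable[ℱ t] (B t)) (x : ℝ) :
    ∀ n ≤ T, Measurable[ℱ (n + 1)] (stoppedLog B σ ε x n) := by
  intro n
  induction n with
  | zero => exact fun _ => measurable_const
  | succ n ih =>
    intro hn
    have ht : n + 1 ∈ Finset.Icc 1 T := Finset.mem_Icc.2 ⟨by omega, hn⟩
    have hle : ℱ (n + 1) ≤ ℱ (n + 1 + 1) := ℱ.mono (Nat.le_succ _)
    have h1 := (ih (by omega)).mono hle le_rfl
    have h2 := (hB _ ht).mono hle le_rfl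
    have h3 := (h.measurable_sigma _ ht).mono hle le_rfl
    have h4 := h.measurable_noise _ ht
    have hb : Measurable[ℱ (n + 1 + 1)]
        fun ω => if x ≤ stoppedLog B σ ε x n ω then 0 else B (n + 1) ω :=
      Measurable.ite (measurableSet_le measurable_const h1) measurable_const h2
    exact h1.add ((hb.mul h4).sub (((hb.pow_const 2).mul (h3.pow_const 2)).div_const 2))

lemma IsSubGaussianBandit.lintegral_stoppedLog_le [IsProbabilityMeasure μ]
    (h : IsSubGaussianBandit μ ℱ T R a lev σ ε)
    {B : ℕ → Ω → ℝ} (hB : ∀ t ∈ Finset.Icc 1 T, Measurable[ℱ t] (B t)) (x : ℝ) :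
    ∀ n ≤ T, ∫⁻ ω, ENNReal.ofReal (Real.exp (stoppedLog B σ ε x n ω)) ∂μ ≤ 1 := by
  intro n
  induction n with
  | zero => exact fun _ => by simp [stoppedLog]
  | succ n ih =>
    intro hn
    have ht : n + 1 ∈ Finset.Icc 1 T := Finset.mem_Icc.2 ⟨by omega, hn⟩
    have h1 := h.measurable_stoppedLog hB x n (by omega)
    have hb : Measurable[ℱ (n + 1)]
        fun ω => if x ≤ stoppedLog B σ ε x n ω then 0 else B (n + 1) ω :=
      Measurable.ite (measurableSet_le measurable_const h1) measurable_const (hB _ ht)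
    refine le_trans (le_of_eq (lintegral_congr fun ω => ?_)) ((h.lintegral_mul_exp_le ht hb
      (ENNReal.measurable_ofReal.comp (Real.measurable_exp.comp h1))).trans (ih (by omega)))
    simp only [Function.comp_apply]
    rw [← ENNReal.ofReal_mul (Real.exp_pos _).le, ← Real.exp_add]
    rfl

/-- Maximal inequality for the exponential supermartingale with predictable exponents `B t`. -/
lemma IsSubGaussianBandit.measure_exists_le [IsProbabilityMeasure μ]
    (h : IsSubGaussianBandit μ ℱ T R a lev σ ε)
    {B : ℕ → Ω → ℝ} (hB : ∀ t ∈ Finset.Icc 1 T, Measurable[ℱ t] (B t)) (x : ℝ) :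
    μ {ω | ∃ n ≤ T, x ≤ ∑ s ∈ Finset.Icc 1 n, (B s ω * ε s ω - B s ω ^ 2 * σ s ω ^ 2 / 2)}
      ≤ ENNReal.ofReal (Real.exp (-x)) := by
  have hsub : {ω | ∃ n ≤ T,
      x ≤ ∑ s ∈ Finset.Icc 1 n, (B s ω * ε s ω - B s ω ^ 2 * σ s ω ^ 2 / 2)}
      ⊆ {ω | ENNReal.ofReal (Real.exp x) ≤ ENNReal.ofReal (Real.exp (stoppedLog B σ ε x T ω))} := by
    rintro ω ⟨n, hn, hx⟩
    rcases stoppedLog_eq_or_le B σ ε x ω T with h | ⟨h, -⟩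
    · exact ENNReal.ofReal_le_ofReal (Real.exp_le_exp.2 h)
    · exact absurd hx (not_le.2 (h n hn))
  have hmeas : Measurable fun ω => ENNReal.ofReal (Real.exp (stoppedLog B σ ε x T ω)) :=
    ENNReal.measurable_ofReal.comp (Real.measurable_exp.comp
      ((h.measurable_stoppedLog hB x T le_rfl).mono (ℱ.le _) le_rfl))
  have hpos : ENNReal.ofReal (Real.exp x) ≠ 0 := by simpa using Real.exp_pos x
  refine (measure_mono hsub).trans ((meas_ge_le_lintegral_div hmeas.aemeasurable hpos
    ENNReal.ofReal_ne_top).trans ?_)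
  rw [Real.exp_neg, ENNReal.ofReal_inv_of_pos (Real.exp_pos x), ← one_div]
  gcongr
  exact h.lintegral_stoppedLog_le hB x T le_rfl

/-- One round of noise exceeds the `x`-fold of a predictable upper bound `η` on its variance proxy
with a sub-Gaussian probability. -/
lemma IsSubGaussianBandit.measure_noise_le [IsProbabilityMeasure μ]
    (h : IsSubGaussianBandit μ ℱ T R a lev σ ε) {t : ℕ} (ht : t ∈ Finset.Icc 1 T) {η : Ω → ℝ}
    (hη : Measurable[ℱ t] η) (hη0 : ∀ ω, 0 < η ω) (hση : ∀ ω, σ t ω ≤ η ω) {x : ℝ} (hx : 0 ≤ x) :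
    μ {ω | η ω * x < |ε t ω|} ≤ 2 * ENNReal.ofReal (Real.exp (-(x ^ 2 / 2))) := by
  have hside : ∀ c : ℝ, c ^ 2 = x ^ 2 → μ {ω | η ω * x ^ 2 ≤ c * ε t ω}
      ≤ ENNReal.ofReal (Real.exp (-(x ^ 2 / 2))) := by
    intro c hc
    have hB : Measurable[ℱ t] fun ω => c / η ω := measurable_const.div hη
    have hle := h.lintegral_mul_exp_le ht hB (Z := fun _ => 1) measurable_const
    simp only [one_mul, lintegral_const, measure_univ] at hle
    have hsub : {ω | η ω * x ^ 2 ≤ c * ε t ω} ⊆ {ω | ENNReal.ofReal (Real.exp (x ^ 2 / 2)) ≤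
        ENNReal.ofReal (Real.exp (c / η ω * ε t ω - (c / η ω) ^ 2 * σ t ω ^ 2 / 2))} := by
      intro ω hω
      refine ENNReal.ofReal_le_ofReal (Real.exp_le_exp.2 ?_)
      have h0 := hη0 ω
      have h1 : x ^ 2 ≤ c / η ω * ε t ω := by
        rw [div_mul_eq_mul_div, le_div_iff₀ h0, mul_comm]; exact hω
      have h2 : (c / η ω) ^ 2 * σ t ω ^ 2 ≤ x ^ 2 := by
        have h3 : σ t ω ^ 2 ≤ η ω ^ 2 := pow_le_pow_left₀ (h.sigma_nonneg t ht ω) (hση ω) 2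
        rw [div_pow, hc, div_mul_eq_mul_div, div_le_iff₀ (by positivity)]
        exact mul_le_mul_of_nonneg_left h3 (sq_nonneg x)
      linarith
    have hmeas : Measurable fun ω =>
        ENNReal.ofReal (Real.exp (c / η ω * ε t ω - (c / η ω) ^ 2 * σ t ω ^ 2 / 2)) := by
      have h1 := hB.mono (ℱ.le t) le_rfl
      have h2 := (h.measurable_noise t ht).mono (ℱ.le _) le_rfl
      have h3 := (h.measurable_sigma t ht).mono (ℱ.le _) le_rfl
      exact ENNReal.measurable_ofReal.comp (Real.measurable_exp.comp
        ((h1.mul h2).sub (((h1.pow_const 2).mul (h3.pow_const 2)).div_const 2)))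
    have hpos : ENNReal.ofReal (Real.exp (x ^ 2 / 2)) ≠ 0 := by simpa using Real.exp_pos _
    refine (measure_mono hsub).trans ((meas_ge_le_lintegral_div hmeas.aemeasurable hpos
      ENNReal.ofReal_ne_top).trans ?_)
    rw [Real.exp_neg, ENNReal.ofReal_inv_of_pos (Real.exp_pos _), ← one_div]
    gcongr
  have hunion : {ω | η ω * x < |ε t ω|} ⊆
      {ω | η ω * x ^ 2 ≤ x * ε t ω} ∪ {ω | η ω * x ^ 2 ≤ -x * ε t ω} := by
    intro ω hω
    simp only [Set.mem_ofPred_eq] at hω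
    rcases lt_abs.1 hω with h1 | h1
    · left
      simp only [Set.mem_ofPred_eq]
      nlinarith
    · right
      simp only [Set.mem_ofPred_eq]
      nlinarith
  refine (measure_mono hunion).trans ((measure_union_le _ _).trans ?_)
  rw [two_mul]
  exact add_le_add (hside x rfl) (hside (-x) (neg_sq x))

end Maximal

/-! ### Validity of the confidence sets -/

lemma exists_finset_cover {A : Type*} {F : Set (A → ℝ)} {α : ℝ≥0} {N : ℕ}
    (hN : supCoveringNumber F α = N) :
    ∃ G : Finset (A → ℝ), G.card = N ∧ (∀ g ∈ G, g ∈ F) ∧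
      ∀ f ∈ F, ∃ g ∈ G, ∀ x, |g x - f x| ≤ α := by
  classical
  have hfin : Metric.coveringNumber α (UniformFun.ofFun '' F) ≠ ⊤ := by
    have : Metric.coveringNumber α (UniformFun.ofFun '' F) = N := hN
    rw [this]
    exact ENat.natCast_ne_top N
  obtain ⟨E, hEF, hEfin, hcov, hcard⟩ := Metric.exists_set_encard_eq_coveringNumber hfin
  refine ⟨hEfin.toFinset.image UniformFun.toFun, ?_, ?_, ?_⟩
  · rw [Finset.card_image_of_injective _ UniformFun.toFun.injective]
    have h1 : E.encard = N := hcard.trans hN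
    rw [hEfin.encard_eq_coe_toFinset_card] at h1
    exact_mod_cast h1
  · intro g hg
    obtain ⟨e, he, rfl⟩ := Finset.mem_image.1 hg
    obtain ⟨f, hf, rfl⟩ := hEF (hEfin.mem_toFinset.1 he)
    exact hf
  · intro f hf
    obtain ⟨e, he, hdist⟩ := hcov (Set.mem_image_of_mem UniformFun.ofFun hf)
    refine ⟨UniformFun.toFun e, Finset.mem_image_of_mem _ (hEfin.mem_toFinset.2 he), fun x => ?_⟩
    have h1 : edist (f x) (UniformFun.toFun e x) ≤ α :=
      (UniformFun.edist_eval_le (f := UniformFun.ofFun f) (g := e) (x := x)).trans hdist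
    rw [edist_dist, ← ENNReal.ofReal_coe_nnreal] at h1
    have h2 := (ENNReal.ofReal_le_ofReal_iff α.2).1 h1
    rwa [Real.dist_eq, abs_sub_comm] at h2

/-- `u` is the error of an empirical risk minimizer, `u + v` that of a nearby centre of the cover.
The class is not assumed bounded; that the minimizer beats the true function controls the
discretization error by the size `m` of the noise instead. -/
lemma sum_sq_error_le {ι : Type*} (S : Finset ι) {u v e : ι → ℝ} {α η m y : ℝ} (hη : 0 < η)
    (hα : 0 ≤ α)
    (herm : ∑ s ∈ S, (u s - e s) ^ 2 ≤ ∑ s ∈ S, e s ^ 2) (hv : ∀ s ∈ S, |v s| ≤ α)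
    (he : ∀ s ∈ S, |e s| ≤ m)
    (hdev : ∑ s ∈ S, ((u s + v s) * e s / (2 * η ^ 2) - (u s + v s) ^ 2 / (8 * η ^ 2)) ≤ y) :
    ∑ s ∈ S, u s ^ 2 ≤ 8 * η ^ 2 * y + 8 * α * S.card * m + S.card * α ^ 2 := by
  have hU : ∑ s ∈ S, u s ^ 2 ≤ ∑ s ∈ S, 2 * (u s * e s) := by
    have : ∑ s ∈ S, (u s - e s) ^ 2
        = ∑ s ∈ S, u s ^ 2 - ∑ s ∈ S, 2 * (u s * e s) + ∑ s ∈ S, e s ^ 2 := by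
      rw [← Finset.sum_sub_distrib, ← Finset.sum_add_distrib]
      exact Finset.sum_congr rfl fun s _ => by ring
    linarith
  have hue : ∑ s ∈ S, 2 * (u s * e s) ≤ 2 * m * ∑ s ∈ S, |u s| := by
    rw [Finset.mul_sum]
    refine Finset.sum_le_sum fun s hs => ?_
    have h1 : u s * e s ≤ |u s| * m :=
      (le_abs_self _).trans ((abs_mul _ _).le.trans
        (mul_le_mul_of_nonneg_left (he s hs) (abs_nonneg _)))
    linarith
  have habs : ∑ s ∈ S, |u s| ≤ 2 * S.card * m := by
    have hcs : (∑ s ∈ S, |u s|) ^ 2 ≤ S.card * ∑ s ∈ S, u s ^ 2 := by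
      have := sq_sum_le_card_mul_sum_sq (s := S) (f := fun s => |u s|)
      simpa only [sq_abs] using this
    have h0 : 0 ≤ ∑ s ∈ S, |u s| := Finset.sum_nonneg fun s _ => abs_nonneg _
    rcases h0.eq_or_lt with h0 | h0
    · rw [← h0]
      rcases S.eq_empty_or_nonempty with rfl | ⟨s, hs⟩
      · simp
      · have : 0 ≤ m := (abs_nonneg _).trans (he s hs)
        positivity
    · have h1 : (S.card : ℝ) * ∑ s ∈ S, u s ^ 2 ≤ S.card * (2 * m * ∑ s ∈ S, |u s|) :=
        mul_le_mul_of_nonneg_left (hU.trans hue) (Nat.cast_nonneg _)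
      nlinarith
  have hdev' : ∑ s ∈ S, (2 * ((u s + v s) * e s) - (u s + v s) ^ 2 / 2) ≤ 4 * η ^ 2 * y := by
    have : ∑ s ∈ S, (2 * ((u s + v s) * e s) - (u s + v s) ^ 2 / 2) = 4 * η ^ 2 *
        ∑ s ∈ S, ((u s + v s) * e s / (2 * η ^ 2) - (u s + v s) ^ 2 / (8 * η ^ 2)) := by
      rw [Finset.mul_sum]
      exact Finset.sum_congr rfl fun s _ => by field_simp; ring
    rw [this]
    exact mul_le_mul_of_nonneg_left hdev (by positivity)
  have hpt : ∑ s ∈ S, 2 * (u s * e s) ≤ ∑ s ∈ S, ((2 * ((u s + v s) * e s) - (u s + v s) ^ 2 / 2)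
      + u s ^ 2 / 2 + α * |u s| + (α ^ 2 / 2 + 2 * α * m)) := by
    refine Finset.sum_le_sum fun s hs => ?_
    have h1 : u s * v s ≤ |u s| * α := (le_abs_self _).trans ((abs_mul _ _).le.trans
      (mul_le_mul_of_nonneg_left (hv s hs) (abs_nonneg _)))
    have h2 : v s ^ 2 ≤ α ^ 2 := by
      rw [← sq_abs]; exact pow_le_pow_left₀ (abs_nonneg _) (hv s hs) 2
    have h3 : -(v s * e s) ≤ α * m := (neg_le_abs _).trans ((abs_mul _ _).le.trans
      (mul_le_mul (hv s hs) (he s hs) (abs_nonneg _) hα))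
    nlinarith
  rw [Finset.sum_add_distrib, Finset.sum_add_distrib, Finset.sum_add_distrib, ← Finset.sum_div,
    ← Finset.mul_sum, ← Finset.mul_sum, Finset.sum_const, nsmul_eq_mul] at hpt
  rw [← Finset.mul_sum] at hU
  have hαu : α * ∑ s ∈ S, |u s| ≤ α * (2 * S.card * m) := mul_le_mul_of_nonneg_left habs hα
  linarith

/-- If the noise level `η * M` is small compared to `C`, the discretization error is covered by the
second term of the confidence radius, and otherwise by a fraction of the first one. -/
lemma discretization_error_le {n t T C η M : ℝ} (hn : 0 ≤ n) (hnt : n ≤ t) (htT : t ≤ T)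
    (hT : 1 ≤ T) (hC : 0 < C) (hCT : 1 ≤ C * T) (hMT : 16 * M ^ 2 ≤ C * T) (hη : 0 < η) :
    8 * (1 / T ^ 2) * n * (η * M) + n * (1 / T ^ 2) ^ 2
      ≤ 4 * η ^ 2 + 4 * t * (1 / T ^ 2) * C := by
  have hT0 : 0 < T := by linarith
  set α := 1 / T ^ 2 with hα
  have hα0 : 0 < α := by positivity
  have hαT : α * T ^ 2 = 1 := by rw [hα]; field_simp
  have hαC : α ≤ C := by
    rw [hα, div_le_iff₀ (by positivity)]
    nlinarith
  have hnα : 0 ≤ n * α := by positivity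
  rcases le_or_gt (η * M) (C / 4) with h | h
  · have h1 : n * α * (η * M) ≤ n * α * (C / 4) := mul_le_mul_of_nonneg_left h hnα
    have h2 : n * α * α ≤ n * α * C := mul_le_mul_of_nonneg_left hαC hnα
    have h3 : n * α * C ≤ t * α * C := by gcongr
    nlinarith [sq_nonneg η]
  · set x := η * M with hx
    have hx0 : 0 < x := by linarith
    have h0 : n * α * T ≤ 1 := by
      have : n * (α * T) ≤ T * (α * T) := mul_le_mul_of_nonneg_right (hnt.trans htT) (by positivity)
      nlinarith
    have hx2 : 16 * x ^ 2 ≤ η ^ 2 * (C * T) := by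
      rw [hx, mul_pow]; nlinarith [sq_nonneg η]
    -- The threshold `C / 4 < x` turns an error linear in `x` into one quadratic in `x`.
    have h1 : 8 * (n * α) * x ≤ 2 * η ^ 2 := by
      have h2 : C * x ≤ 4 * x ^ 2 := by nlinarith
      have h3 : C * (n * α * x) ≤ C * (η ^ 2 / 4) := by
        calc C * (n * α * x) = n * α * (C * x) := by ring
          _ ≤ n * α * (4 * x ^ 2) := mul_le_mul_of_nonneg_left h2 hnα
          _ ≤ n * α * (η ^ 2 * (C * T) / 4) := mul_le_mul_of_nonneg_left (by linarith) hnα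
          _ = (n * α * T) * (C * (η ^ 2 / 4)) := by ring
          _ ≤ 1 * (C * (η ^ 2 / 4)) := mul_le_mul_of_nonneg_right h0 (by positivity)
          _ = _ := one_mul _
      have := le_of_mul_le_mul_left h3 hC
      linarith
    have h4 : n * α * α ≤ η ^ 2 := by
      have h5 : C ^ 2 ≤ η ^ 2 * (C * T) := by nlinarith
      have h6 : C ≤ η ^ 2 * T := le_of_mul_le_mul_left (by nlinarith) hC
      have h7 : 1 ≤ η ^ 2 * T ^ 2 := by nlinarith
      have h8 : α ≤ η ^ 2 := by nlinarith
      have h9 : n * α ≤ 1 := by nlinarith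
      nlinarith
    have h10 : 0 ≤ 4 * t * α * C := by
      have : 0 ≤ t := hn.trans hnt
      positivity
    nlinarith [sq_nonneg η]

section GoodEvent

variable {Ω A : Type*} [MeasurableSpace A] {mΩ : MeasurableSpace Ω} {μ : Measure Ω}
  {ℱ : Filtration ℕ mΩ} {T : ℕ} {R : ℝ} {a : ℕ → Ω → A} {lev : ℕ → Ω → ℕ} {σ ε : ℕ → Ω → ℝ}

/-- Deviation inequality at level `l` for a fixed function `g`, uniformly over the rounds. -/
lemma IsSubGaussianBandit.measure_deviation_le [IsProbabilityMeasure μ]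
    (h : IsSubGaussianBandit μ ℱ T R a lev σ ε) {σbar : ℝ} (hσbar : 0 < σbar)
    (hlev : ∀ t ∈ Finset.Icc 1 T, ∀ ω, σ t ω ≤ 2 ^ (lev t ω + 1) * σbar)
    {g fstar : A → ℝ} (hg : Measurable g) (hf : Measurable fstar) (l : ℕ) (y : ℝ) :
    μ {ω | ∃ t ∈ Finset.Icc 1 T, y ≤ ∑ s ∈ levelData (fun s => lev s ω) t l,
      ((g (a s ω) - fstar (a s ω)) * ε s ω / (2 * (2 ^ (l + 1) * σbar) ^ 2)
        - (g (a s ω) - fstar (a s ω)) ^ 2 / (8 * (2 ^ (l + 1) * σbar) ^ 2))}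
      ≤ ENNReal.ofReal (Real.exp (-y)) := by
  classical
  set η : ℝ := 2 ^ (l + 1) * σbar with hη
  have hη0 : 0 < η := by positivity
  set B : ℕ → Ω → ℝ := fun s ω =>
    if lev s ω = l then (g (a s ω) - fstar (a s ω)) / (2 * η ^ 2) else 0 with hB
  have hBm : ∀ t ∈ Finset.Icc 1 T, Measurable[ℱ t] (B t) := fun t ht =>
    Measurable.ite (h.measurable_level t ht (measurableSet_singleton l))
      (((hg.comp (h.measurable_action t ht)).sub
        (hf.comp (h.measurable_action t ht))).div_const _) measurable_const
  refine (measure_mono ?_).trans (h.measure_exists_le hBm y)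
  rintro ω ⟨t, ht, hy⟩
  obtain ⟨ht1, htT⟩ := Finset.mem_Icc.1 ht
  refine ⟨t - 1, by omega, hy.trans ?_⟩
  have hIcc : Finset.Icc 1 (t - 1) = Finset.Ico 1 t := by
    ext s; simp only [Finset.mem_Icc, Finset.mem_Ico]; omega
  rw [hIcc, levelData, Finset.sum_filter]
  refine Finset.sum_le_sum fun s hs => ?_
  have hs' : s ∈ Finset.Icc 1 T := by
    rw [Finset.mem_Ico] at hs; rw [Finset.mem_Icc]; omega
  by_cases hsl : lev s ω = l
  · simp only [hB, hsl, if_true]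
    have h1 : σ s ω ^ 2 ≤ η ^ 2 := by
      have h2 := hlev s hs' ω
      rw [hsl] at h2
      exact pow_le_pow_left₀ (h.sigma_nonneg s hs' ω) h2 2
    have h3 : ((g (a s ω) - fstar (a s ω)) / (2 * η ^ 2)) ^ 2 * σ s ω ^ 2 / 2
        ≤ ((g (a s ω) - fstar (a s ω)) / (2 * η ^ 2)) ^ 2 * η ^ 2 / 2 := by gcongr
    have h4 : ((g (a s ω) - fstar (a s ω)) / (2 * η ^ 2)) ^ 2 * η ^ 2 / 2
        = (g (a s ω) - fstar (a s ω)) ^ 2 / (8 * η ^ 2) := by field_simp; ring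
    have h5 : (g (a s ω) - fstar (a s ω)) / (2 * η ^ 2) * ε s ω
        = (g (a s ω) - fstar (a s ω)) * ε s ω / (2 * η ^ 2) := by ring
    rw [h5]
    linarith
  · simp [hB, hsl]

/-- The event on which the confidence sets are valid: the deviation inequality holds for all centres
`g ∈ G` at all levels, and no noise variable is much larger than its level allows. -/
def IsGoodSample (fstar : A → ℝ) (G : Finset (A → ℝ)) (T L : ℕ) (σbar y M : ℝ) (a : ℕ → A)
    (lev : ℕ → ℕ) (ε : ℕ → ℝ) : Prop :=
  (∀ g ∈ G, ∀ l < L, ∀ t ∈ Finset.Icc 1 T, ∑ s ∈ levelData lev t l,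
      ((g (a s) - fstar (a s)) * ε s / (2 * (2 ^ (l + 1) * σbar) ^ 2)
        - (g (a s) - fstar (a s)) ^ 2 / (8 * (2 ^ (l + 1) * σbar) ^ 2)) ≤ y) ∧
    ∀ t ∈ Finset.Icc 1 T, |ε t| ≤ 2 ^ (lev t + 1) * σbar * M

lemma IsSubGaussianBandit.measure_not_good_le [IsProbabilityMeasure μ]
    (h : IsSubGaussianBandit μ ℱ T R a lev σ ε) {σbar : ℝ} (hσbar : 0 < σbar)
    (hlev : ∀ t ∈ Finset.Icc 1 T, ∀ ω, σ t ω ≤ 2 ^ (lev t ω + 1) * σbar)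
    {G : Finset (A → ℝ)} {fstar : A → ℝ} (hG : ∀ g ∈ G, Measurable g) (hf : Measurable fstar)
    (L : ℕ) (y : ℝ) {M : ℝ} (hM : 0 ≤ M) :
    μ {ω | ¬ IsGoodSample fstar G T L σbar y M (fun t => a t ω) (fun t => lev t ω)
        (fun t => ε t ω)}
      ≤ ENNReal.ofReal (G.card * L * Real.exp (-y) + 2 * T * Real.exp (-(M ^ 2 / 2))) := by
  set E₁ : (A → ℝ) → ℕ → Set Ω := fun g l =>
    {ω | ∃ t ∈ Finset.Icc 1 T, y ≤ ∑ s ∈ levelData (fun s => lev s ω) t l,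
      ((g (a s ω) - fstar (a s ω)) * ε s ω / (2 * (2 ^ (l + 1) * σbar) ^ 2)
        - (g (a s ω) - fstar (a s ω)) ^ 2 / (8 * (2 ^ (l + 1) * σbar) ^ 2))} with hE₁
  set E₂ : ℕ → Set Ω := fun t => {ω | 2 ^ (lev t ω + 1) * σbar * M < |ε t ω|} with hE₂
  have hsub : {ω | ¬ IsGoodSample fstar G T L σbar y M (fun t => a t ω) (fun t => lev t ω)
      (fun t => ε t ω)} ⊆ (⋃ g ∈ G, ⋃ l ∈ Finset.range L, E₁ g l) ∪ ⋃ t ∈ Finset.Icc 1 T, E₂ t := by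
    intro ω hω
    by_contra hnot
    simp only [Set.mem_union, Set.mem_iUnion, not_or, not_exists] at hnot
    refine hω ⟨fun g hg l hl t ht => ?_, fun t ht => ?_⟩
    · by_contra! hlt
      exact hnot.1 g hg l (Finset.mem_range.2 hl) ⟨t, ht, hlt.le⟩
    · by_contra! hlt
      exact hnot.2 t ht hlt
  have h2 : ∀ t ∈ Finset.Icc 1 T, μ (E₂ t) ≤ ENNReal.ofReal (2 * Real.exp (-(M ^ 2 / 2))) := by
    intro t ht
    have hη : Measurable[ℱ t] fun ω => (2 : ℝ) ^ (lev t ω + 1) * σbar :=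
      (measurable_from_top (f := fun n : ℕ => (2 : ℝ) ^ (n + 1) * σbar)).comp
        (h.measurable_level t ht)
    refine (h.measure_noise_le ht hη (fun ω => by positivity) (hlev t ht) hM).trans (le_of_eq ?_)
    rw [ENNReal.ofReal_mul (by norm_num)]
    simp
  calc μ _ ≤ μ (⋃ g ∈ G, ⋃ l ∈ Finset.range L, E₁ g l) + μ (⋃ t ∈ Finset.Icc 1 T, E₂ t) :=
        (measure_mono hsub).trans (measure_union_le _ _)
    _ ≤ (∑ g ∈ G, ∑ l ∈ Finset.range L, ENNReal.ofReal (Real.exp (-y)))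
        + ∑ t ∈ Finset.Icc 1 T, ENNReal.ofReal (2 * Real.exp (-(M ^ 2 / 2))) := by
        gcongr
        · refine (measure_biUnion_finset_le _ _).trans (Finset.sum_le_sum fun g hg => ?_)
          refine (measure_biUnion_finset_le _ _).trans (Finset.sum_le_sum fun l _ => ?_)
          exact h.measure_deviation_le hσbar hlev (hG g hg) hf l y
        · exact (measure_biUnion_finset_le _ _).trans (Finset.sum_le_sum h2)
    _ = _ := by
        have hexp := (Real.exp_pos (-y)).le
        have hexp2 := (Real.exp_pos (-(M ^ 2 / 2))).le
        rw [Finset.sum_const, Finset.sum_const, Finset.sum_const, Finset.card_range,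
          Nat.card_Icc, Nat.add_sub_cancel, ENNReal.ofReal_add (by positivity) (by positivity)]
        simp only [nsmul_eq_mul]
        rw [← ENNReal.ofReal_natCast, ← ENNReal.ofReal_natCast, ← ENNReal.ofReal_natCast,
          ← ENNReal.ofReal_mul (by positivity), ← ENNReal.ofReal_mul (by positivity),
          ← ENNReal.ofReal_mul (by positivity)]
        congr 2 <;> ring

end GoodEvent

/-- On a good sample the true function belongs to every confidence set. The constant `1 / 2` in the
deviation bound is what pays for the discretization. -/
lemma mem_confSet_of_isGoodSample {A : Type*} {F : Set (A → ℝ)} {fstar : A → ℝ}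
    (hstar : fstar ∈ F) {G : Finset (A → ℝ)} {T L N : ℕ} {C δ σbar M : ℝ} (hσbar : 0 < σbar)
    (hcov : ∀ f ∈ F, ∃ g ∈ G, ∀ x, |g x - f x| ≤ 1 / (T : ℝ) ^ 2)
    (hC : 0 < C) (hCT : 1 ≤ C * T) (hMT : 16 * M ^ 2 ≤ C * T)
    {a : ℕ → A} {lev : ℕ → ℕ} {ε : ℕ → ℝ}
    (hgood : IsGoodSample fstar G T L σbar (Real.log (2 * N * L / δ) - 1 / 2) M a lev ε)
    {t l : ℕ} (ht : t ∈ Finset.Icc 1 T) (hl : l < L) {fhat : A → ℝ}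
    (herm : IsERM F a (fun t => fstar (a t) + ε t) (levelData lev t l) fhat) :
    fstar ∈ confSet F a (levelData lev t l) fhat
      (radius C δ (1 / (T : ℝ) ^ 2) σbar N L t l) := by
  obtain ⟨ht1, htT⟩ := Finset.mem_Icc.1 ht
  have hTR : (1 : ℝ) ≤ T := by exact_mod_cast ht1.trans htT
  set S := levelData lev t l with hS
  set η : ℝ := 2 ^ (l + 1) * σbar with hη
  have hη0 : 0 < η := by positivity
  obtain ⟨g, hg, hgf⟩ := hcov fhat herm.1
  have hcard : (S.card : ℝ) ≤ t := by
    have : S.card ≤ (Finset.Ico 1 t).card := Finset.card_filter_le _ _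
    rw [Nat.card_Ico] at this
    exact_mod_cast this.trans (Nat.sub_le _ _)
  have hmain := sum_sq_error_le S (u := fun s => fhat (a s) - fstar (a s))
    (v := fun s => g (a s) - fhat (a s)) (e := ε) (α := 1 / (T : ℝ) ^ 2) (η := η) (m := η * M)
    (y := Real.log (2 * N * L / δ) - 1 / 2) hη0 (by positivity) ?_ (fun s _ => hgf _) ?_ ?_
  · refine ⟨hstar, ?_⟩
    have hdisc := discretization_error_le (n := S.card) (t := t) (T := T) (Nat.cast_nonneg _) hcard
      (by exact_mod_cast htT) hTR hC hCT hMT hη0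
    have hs := Real.sqrt_nonneg (η ^ 2 * Real.log (4 * t * (t + 1) * L / δ))
    have hα : 0 ≤ 4 * (t : ℝ) * (1 / (T : ℝ) ^ 2) := by positivity
    have hle : ∑ s ∈ S, (fstar (a s) - fhat (a s)) ^ 2
        ≤ 8 * η ^ 2 * Real.log (2 * N * L / δ) + 4 * t * (1 / (T : ℝ) ^ 2)
          * (C + Real.sqrt (η ^ 2 * Real.log (4 * t * (t + 1) * L / δ))) := by
      have h1 : ∑ s ∈ S, (fstar (a s) - fhat (a s)) ^ 2
          = ∑ s ∈ S, (fhat (a s) - fstar (a s)) ^ 2 := Finset.sum_congr rfl fun s _ => by ring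
      rw [h1]
      nlinarith [mul_nonneg hα hs]
    rw [radius, Real.sq_sqrt ((Finset.sum_nonneg fun s _ => sq_nonneg _).trans hle)]
    exact hle
  · have h1 := herm.2 fstar hstar
    refine le_trans (le_of_eq ?_) (h1.trans (le_of_eq ?_))
    · exact Finset.sum_congr rfl fun s _ => by ring
    · exact Finset.sum_congr rfl fun s _ => by ring
  · intro s hs
    obtain ⟨hs1, hs2⟩ := Finset.mem_filter.1 hs
    have := hgood.2 s (by rw [Finset.mem_Ico] at hs1; rw [Finset.mem_Icc]; omega)
    rwa [hs2] at this
  · refine le_trans (le_of_eq ?_) (hgood.1 g hg l hl t ht)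
    refine Finset.sum_congr rfl fun s _ => ?_
    simp only [← hη]
    ring

/-! ### Regret on the event that the confidence sets are valid -/

section Path

variable {A : Type*} {F : Set (A → ℝ)} {fstar : A → ℝ} {T L : ℕ} {σbar : ℝ} {β : ℕ → ℕ → ℝ}
  {D : ℕ → Set A} {σ r : ℕ → ℝ} {a : ℕ → A} {lev : ℕ → ℕ} {fhat : ℕ → ℕ → A → ℝ} {C : ℝ}

lemma sSup_sub_le (hbdd : ∀ x, |fstar x| ≤ C) {S : Set A} {x : A} (hx : x ∈ S) :
    sSup (fstar '' S) - fstar x ≤ 2 * C := by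
  have h1 : sSup (fstar '' S) ≤ C := csSup_le ⟨_, Set.mem_image_of_mem _ hx⟩ (by
    rintro _ ⟨z, -, rfl⟩
    exact (le_abs_self _).trans (hbdd z))
  have h2 := (abs_le.1 (hbdd x)).1
  linarith

lemma regret_le_two_mul (hbdd : ∀ x, |fstar x| ≤ C) (ha : ∀ t ∈ Finset.Icc 1 T, a t ∈ D t) :
    regret fstar D a T ≤ 2 * C * T := by
  refine (Finset.sum_le_sum fun t ht => sSup_sub_le hbdd (ha t ht)).trans (le_of_eq ?_)
  rw [Finset.sum_const, Nat.card_Icc, Nat.add_sub_cancel, nsmul_eq_mul]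
  ring

/-- Optimism: a regret larger than `e` in round `t` is witnessed by a member of the confidence set
of the level of that round. -/
lemma IsML2Path.exists_wide (hp : IsML2Path F T L σbar β D σ r a lev fhat)
    (hconf : ∀ t ∈ Finset.Icc 1 T, ∀ l < L,
      fstar ∈ confSet F a (levelData lev t l) (fhat t l) (β t l))
    {t : ℕ} (ht : t ∈ Finset.Icc 1 T) {e : ℝ} (he : e < sSup (fstar '' D t) - fstar (a t)) :
    ∃ f ∈ confSet F a (levelData lev t (lev t)) (fhat t (lev t)) (β t (lev t)),
      e < f (a t) - fstar (a t) := by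
  obtain ⟨_, ⟨x, hx, rfl⟩, hlt⟩ := exists_lt_of_lt_csSup
    (⟨_, Set.mem_image_of_mem _ (hp.action_mem t ht)⟩ : (fstar '' D t).Nonempty)
    (show e + fstar (a t) < sSup (fstar '' D t) by linarith)
  have h1 : ((fstar x : ℝ) : EReal) ≤ optIndex F L β a lev fhat t x :=
    le_iInf fun l => le_iSup₂_of_le (f := fun (f : A → ℝ)
      (_ : f ∈ confSet F a (levelData lev t l) (fhat t l) (β t l)) => ((f x : ℝ) : EReal))
      fstar (hconf t ht l l.2) le_rfl
  have h2 : optIndex F L β a lev fhat t (a t)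
      ≤ ⨆ f ∈ confSet F a (levelData lev t (lev t)) (fhat t (lev t)) (β t (lev t)),
        ((f (a t) : ℝ) : EReal) :=
    iInf_le (fun l : Fin L => ⨆ f ∈ confSet F a (levelData lev t l) (fhat t l) (β t l),
      ((f (a t) : ℝ) : EReal)) ⟨lev t, hp.level_lt t ht⟩
  have h3 : ((e + fstar (a t) : ℝ) : EReal)
      < ⨆ f ∈ confSet F a (levelData lev t (lev t)) (fhat t (lev t)) (β t (lev t)),
        ((f (a t) : ℝ) : EReal) :=
    (EReal.coe_lt_coe_iff.2 hlt).trans_le (h1.trans ((hp.action_max t ht x hx).trans h2))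
  obtain ⟨f, h4⟩ := lt_iSup_iff.1 h3
  obtain ⟨hf, hlt'⟩ := lt_iSup_iff.1 h4
  exact ⟨f, hf, by linarith [EReal.coe_lt_coe_iff.1 hlt']⟩

lemma sum_sq_sub_le_of_mem_confSet {S : Finset ℕ} {f g h : A → ℝ} {b : ℝ}
    (hf : f ∈ confSet F a S h b) (hg : g ∈ confSet F a S h b) :
    ∑ s ∈ S, (f (a s) - g (a s)) ^ 2 ≤ 4 * b ^ 2 := by
  have h1 : ∑ s ∈ S, (f (a s) - g (a s)) ^ 2
      ≤ ∑ s ∈ S, (2 * (f (a s) - h (a s)) ^ 2 + 2 * (g (a s) - h (a s)) ^ 2) :=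
    Finset.sum_le_sum fun s _ => by
      nlinarith [sq_nonneg ((f (a s) - h (a s)) + (g (a s) - h (a s)))]
  rw [Finset.sum_add_distrib, ← Finset.mul_sum, ← Finset.mul_sum] at h1
  linarith [hf.2, hg.2]

lemma IsML2Path.sum_level_le (hp : IsML2Path F T L σbar β D σ r a lev fhat)
    (hstar : fstar ∈ F) (hbdd : ∀ x, |fstar x| ≤ C) (hC : 0 ≤ C)
    (hconf : ∀ t ∈ Finset.Icc 1 T, ∀ l < L,
      fstar ∈ confSet F a (levelData lev t l) (fhat t l) (β t l))
    {d : ℕ} {e₀ : ℝ} (he₀ : 0 < e₀) (hd : eluderDim F e₀ = d) {l : ℕ} {V : ℝ}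
    (hV0 : 0 ≤ V) (hV : ∀ t ∈ Finset.Icc 1 T, β t l ^ 2 ≤ V) :
    ∑ t ∈ levelData lev (T + 1) l, (sSup (fstar '' D t) - fstar (a t))
      ≤ (levelData lev (T + 1) l).card * e₀ + 2 * C * d
        + 4 * Real.sqrt (d * V * (levelData lev (T + 1) l).card) := by
  have hmem : ∀ t ∈ levelData lev (T + 1) l, t ∈ Finset.Icc 1 T ∧ lev t = l := by
    intro t ht
    obtain ⟨h1, h2⟩ := Finset.mem_filter.1 ht
    rw [Finset.mem_Ico] at h1
    exact ⟨Finset.mem_Icc.2 ⟨h1.1, by omega⟩, h2⟩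
  have h := sum_le_of_card_le (w := fun t => sSup (fstar '' D t) - fstar (a t)) (W := 2 * C)
    (e₀ := e₀) (B := d * (4 * V)) (d := d) (by positivity) he₀ (by positivity)
    (levelData lev (T + 1) l) (fun t ht => sSup_sub_le hbdd (hp.action_mem t (hmem t ht).1)) ?_
  · have h4 : Real.sqrt (d * (4 * V) * (levelData lev (T + 1) l).card)
        = 2 * Real.sqrt (d * V * (levelData lev (T + 1) l).card) := by
      rw [show (d : ℝ) * (4 * V) * (levelData lev (T + 1) l).card
        = 2 ^ 2 * (d * V * (levelData lev (T + 1) l).card) by ring,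
        Real.sqrt_mul (by norm_num), Real.sqrt_sq (by norm_num)]
    rw [h4] at h
    linarith
  · intro e he
    refine card_wide_le hd he (he₀.trans_le he) (by positivity) hstar a _ fun t ht => ?_
    obtain ⟨htl, hte⟩ := Finset.mem_filter.1 ht
    obtain ⟨htT, rfl⟩ := hmem t htl
    obtain ⟨f, hf, hlt⟩ := hp.exists_wide hconf htT hte
    refine ⟨f, hf.1, hlt, ?_⟩
    have hsub : (Finset.filter (fun t => e < sSup (fstar '' D t) - fstar (a t))
        (levelData lev (T + 1) (lev t))).filter (· < t) ⊆ levelData lev t (lev t) := by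
      intro s hs
      obtain ⟨hs1, hs2⟩ := Finset.mem_filter.1 hs
      obtain ⟨hs3, hs4⟩ := Finset.mem_filter.1 (Finset.mem_filter.1 hs1).1
      exact Finset.mem_filter.2 ⟨Finset.mem_Ico.2 ⟨(Finset.mem_Ico.1 hs3).1, hs2⟩, hs4⟩
    calc _ ≤ ∑ s ∈ levelData lev t (lev t), (f (a s) - fstar (a s)) ^ 2 :=
          Finset.sum_le_sum_of_subset_of_nonneg hsub fun _ _ _ => sq_nonneg _
      _ ≤ 4 * β t (lev t) ^ 2 :=
          sum_sq_sub_le_of_mem_confSet hf (hconf t htT _ (hp.level_lt t htT))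
      _ ≤ 4 * V := by linarith [hV t htT]

/-- At level `l ≥ 1` every round has a variance proxy of at least `2 ^ l * σbar`; the rounds at
level `0` are paid for by the second term. -/
lemma IsML2Path.card_level_mul_le (hp : IsML2Path F T L σbar β D σ r a lev fhat)
    (hσbar : 0 < σbar) (l : ℕ) :
    (levelData lev (T + 1) l).card * (2 ^ (l + 1) * σbar) ^ 2
      ≤ 4 * totalVar σ T + 4 * σbar ^ 2 * T := by
  have hpt : ∀ t ∈ levelData lev (T + 1) l,
      (2 ^ (l + 1) * σbar) ^ 2 ≤ 4 * σ t ^ 2 + 4 * σbar ^ 2 := by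
    intro t ht
    obtain ⟨h1, rfl⟩ := Finset.mem_filter.1 ht
    rw [Finset.mem_Ico] at h1
    have h2 := hp.level_lower t (Finset.mem_Icc.2 ⟨h1.1, by omega⟩)
    have h3 : 0 ≤ 2 ^ lev t * σbar := by positivity
    have h4 : (2 ^ lev t * σbar) ^ 2 ≤ σ t ^ 2 + σbar ^ 2 := by
      refine (pow_le_pow_left₀ h3 h2 2).trans ?_
      rcases max_choice σbar (σ t) with h | h <;> rw [h] <;> nlinarith [sq_nonneg (σ t)]
    rw [pow_succ (2 : ℝ) (lev t)]
    nlinarith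
  have hsub : levelData lev (T + 1) l ⊆ Finset.Icc 1 T := by
    intro t ht
    have := (Finset.mem_filter.1 ht).1
    rw [Finset.mem_Ico] at this
    exact Finset.mem_Icc.2 ⟨this.1, by omega⟩
  calc ((levelData lev (T + 1) l).card : ℝ) * (2 ^ (l + 1) * σbar) ^ 2
      = ∑ _t ∈ levelData lev (T + 1) l, (2 ^ (l + 1) * σbar) ^ 2 := by
        rw [Finset.sum_const, nsmul_eq_mul]
    _ ≤ ∑ t ∈ levelData lev (T + 1) l, (4 * σ t ^ 2 + 4 * σbar ^ 2) := Finset.sum_le_sum hpt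
    _ ≤ ∑ t ∈ Finset.Icc 1 T, (4 * σ t ^ 2 + 4 * σbar ^ 2) :=
        Finset.sum_le_sum_of_subset_of_nonneg hsub fun _ _ _ => by positivity
    _ = _ := by
        rw [Finset.sum_add_distrib, ← Finset.mul_sum, Finset.sum_const, Nat.card_Icc,
          Nat.add_sub_cancel, nsmul_eq_mul, totalVar]
        ring

lemma radius_sq_le {δ s : ℝ} {N L t l : ℕ} (hσbar : 0 < σbar) (hC : 0 ≤ C) (hδ : 0 < δ)
    (hL : 0 < L) (hι : 0 ≤ Real.log (2 * N * L / δ)) (hs : 0 ≤ s)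
    (hlog : Real.log (4 * T * (T + 1) * L / δ) ≤ s ^ 2) (ht : t ∈ Finset.Icc 1 T) :
    radius C δ (1 / (T : ℝ) ^ 2) σbar N L t l ^ 2
      ≤ 8 * (2 ^ (l + 1) * σbar) ^ 2 * Real.log (2 * N * L / δ)
        + 4 / T * (C + 2 ^ (l + 1) * σbar * s) := by
  obtain ⟨ht1, htT⟩ := Finset.mem_Icc.1 ht
  have ht0 : (0 : ℝ) < t := by exact_mod_cast ht1
  have htT' : (t : ℝ) ≤ T := by exact_mod_cast htT
  have hT0 : (0 : ℝ) < T := ht0.trans_le htT'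
  have hL0 : (0 : ℝ) < L := by exact_mod_cast hL
  set η : ℝ := 2 ^ (l + 1) * σbar with hη
  have hη0 : 0 < η := by positivity
  have h1 : Real.log (4 * t * (t + 1) * L / δ) ≤ s ^ 2 := by
    refine le_trans (Real.log_le_log (by positivity) ?_) hlog
    gcongr
  have h2 : Real.sqrt (η ^ 2 * Real.log (4 * t * (t + 1) * L / δ)) ≤ η * s := by
    refine Real.sqrt_le_iff.2 ⟨by positivity, ?_⟩
    rw [mul_pow η s 2]
    exact mul_le_mul_of_nonneg_left h1 (sq_nonneg η)
  rw [radius, Real.sq_sqrt (by positivity)]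
  have h3 : 4 * (t : ℝ) * (1 / (T : ℝ) ^ 2) ≤ 4 / T := by
    rw [mul_one_div, div_le_div_iff₀ (by positivity) hT0]
    nlinarith
  have h4 := Real.sqrt_nonneg (η ^ 2 * Real.log (4 * t * (t + 1) * L / δ))
  gcongr

lemma IsML2Path.regret_le {δ s ρ : ℝ} {N d : ℕ}
    (hp : IsML2Path F T L σbar (radius C δ (1 / (T : ℝ) ^ 2) σbar N L) D σ r a lev fhat)
    (hstar : fstar ∈ F) (hbdd : ∀ x, |fstar x| ≤ C) (hC : 0 ≤ C) (hσbar : 0 < σbar)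
    (hδ : 0 < δ) (hL : 0 < L) (hT : 0 < T) (hι : 0 ≤ Real.log (2 * N * L / δ)) (hs : 0 ≤ s)
    (hlog : Real.log (4 * T * (T + 1) * L / δ) ≤ s ^ 2)
    (hρ : ∀ t ∈ Finset.Icc 1 T, max σbar (σ t) ≤ ρ) (hρ0 : 0 ≤ ρ)
    (hconf : ∀ t ∈ Finset.Icc 1 T, ∀ l < L, fstar ∈ confSet F a (levelData lev t l) (fhat t l)
      (radius C δ (1 / (T : ℝ) ^ 2) σbar N L t l))
    (hd : eluderDim F (1 / (T : ℝ) ^ 2) = d) :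
    regret fstar D a T ≤ 1 / T + L * (2 * C * d + 4 * Real.sqrt
      (32 * d * Real.log (2 * N * L / δ) * (totalVar σ T + σbar ^ 2 * T)
        + 4 * d * (C + 2 * ρ * s))) := by
  have hT0 : (0 : ℝ) < T := by exact_mod_cast hT
  set X : ℝ := 32 * d * Real.log (2 * N * L / δ) * (totalVar σ T + σbar ^ 2 * T)
        + 4 * d * (C + 2 * ρ * s) with hX
  have hJ : 0 ≤ totalVar σ T := Finset.sum_nonneg fun _ _ => sq_nonneg _
  have hmaps : ∀ t ∈ Finset.Ico 1 (T + 1), lev t ∈ Finset.range L := by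
    intro t ht
    rw [Finset.mem_Ico] at ht
    exact Finset.mem_range.2 (hp.level_lt t (Finset.mem_Icc.2 ⟨ht.1, by omega⟩))
  have hIcc : Finset.Icc 1 T = Finset.Ico 1 (T + 1) := by
    ext t; simp only [Finset.mem_Icc, Finset.mem_Ico]; omega
  have hlevel : ∀ l ∈ Finset.range L,
      ∑ t ∈ levelData lev (T + 1) l, (sSup (fstar '' D t) - fstar (a t))
        ≤ (levelData lev (T + 1) l).card * (1 / (T : ℝ) ^ 2) + (2 * C * d + 4 * Real.sqrt X) := by
    intro l _
    set η : ℝ := 2 ^ (l + 1) * σbar with hη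
    have hη0 : 0 < η := by positivity
    set n : ℝ := ((levelData lev (T + 1) l).card : ℝ) with hn
    have h1 := hp.sum_level_le hstar hbdd hC hconf (by positivity) hd (l := l)
      (V := 8 * η ^ 2 * Real.log (2 * N * L / δ) + 4 / T * (C + η * s)) (by positivity)
      (fun t ht => radius_sq_le hσbar hC hδ hL hι hs hlog ht)
    have h2 := hp.card_level_mul_le hσbar l
    have hnT : n ≤ T := by
      have h3 : (levelData lev (T + 1) l).card ≤ (Finset.Ico 1 (T + 1)).card :=
        Finset.card_filter_le _ _
      rw [Nat.card_Ico, Nat.add_sub_cancel] at h3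
      rw [hn]
      exact_mod_cast h3
    have hn0 : 0 ≤ n := Nat.cast_nonneg _
    have h4 : n * (4 / T * (C + η * s)) ≤ 4 * (C + 2 * ρ * s) := by
      rcases (levelData lev (T + 1) l).eq_empty_or_nonempty with he | ⟨t, ht⟩
      · rw [hn, he]
        simp only [Finset.card_empty, Nat.cast_zero, zero_mul]
        positivity
      · obtain ⟨h5, h6⟩ := Finset.mem_filter.1 ht
        rw [← hIcc] at h5
        have h7 : η ≤ 2 * ρ := by
          have := (hp.level_lower t h5).trans (hρ t h5)
          rw [h6] at this
          rw [hη, pow_succ]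
          linarith
        calc n * (4 / T * (C + η * s)) ≤ T * (4 / T * (C + 2 * ρ * s)) := by gcongr
          _ = _ := by field_simp
    have h8 : (d : ℝ) * (8 * η ^ 2 * Real.log (2 * N * L / δ) + 4 / T * (C + η * s)) * n ≤ X := by
      have h9 : 8 * d * Real.log (2 * N * L / δ) * (n * η ^ 2) ≤ 8 * d * Real.log (2 * N * L / δ)
          * (4 * totalVar σ T + 4 * σbar ^ 2 * T) := by gcongr
      have h10 : (d : ℝ) * (n * (4 / T * (C + η * s))) ≤ d * (4 * (C + 2 * ρ * s)) := by gcongr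
      rw [hX]
      linarith
    have h11 := Real.sqrt_le_sqrt h8
    linarith
  have hcard : ∑ l ∈ Finset.range L, ((levelData lev (T + 1) l).card : ℝ) = T := by
    have := Finset.card_eq_sum_card_fiberwise (f := lev) (s := Finset.Ico 1 (T + 1))
      (t := Finset.range L) hmaps
    rw [Nat.card_Ico, Nat.add_sub_cancel] at this
    exact_mod_cast this.symm
  calc regret fstar D a T
      = ∑ t ∈ Finset.Ico 1 (T + 1), (sSup (fstar '' D t) - fstar (a t)) := by rw [regret, hIcc]
    _ = ∑ l ∈ Finset.range L,
        ∑ t ∈ levelData lev (T + 1) l, (sSup (fstar '' D t) - fstar (a t)) :=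
        (Finset.sum_fiberwise_of_maps_to hmaps _).symm
    _ ≤ ∑ l ∈ Finset.range L, ((levelData lev (T + 1) l).card * (1 / (T : ℝ) ^ 2)
        + (2 * C * d + 4 * Real.sqrt X)) := Finset.sum_le_sum hlevel
    _ = 1 / T + L * (2 * C * d + 4 * Real.sqrt X) := by
        rw [Finset.sum_add_distrib, ← Finset.sum_mul, hcard, Finset.sum_const, Finset.card_range,
          nsmul_eq_mul]
        congr 1
        field_simp

end Path

/-! ### The size of the parameters -/

lemma logFactor_eq {N T : ℕ} {δ : ℝ} (hN : 1 ≤ N) (hT : 1 ≤ T) (hδ : 0 < δ) :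
    logFactor N T δ = Real.log T + Real.log (1 + Real.log N) + Real.log (1 / δ) := by
  have hT0 : (0 : ℝ) < T := by exact_mod_cast hT
  have hN0 : 0 ≤ Real.log N := Real.log_nonneg (by exact_mod_cast hN)
  rw [logFactor, Real.log_div (by positivity) hδ.ne', Real.log_mul (by positivity) (by positivity),
    one_div, Real.log_inv]
  ring

lemma log_le_logFactor {N T : ℕ} {δ : ℝ} (hN : 1 ≤ N) (hT : 1 ≤ T) (hδ : 0 < δ) (hδ1 : δ < 1) :
    Real.log T ≤ logFactor N T δ := by
  have h1 : 0 ≤ Real.log (1 + Real.log N) := Real.log_nonneg (by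
    linarith [Real.log_nonneg (show (1 : ℝ) ≤ N by exact_mod_cast hN)])
  have h2 : 0 ≤ Real.log (1 / δ) := Real.log_nonneg (by rw [le_div_iff₀ hδ]; linarith)
  rw [logFactor_eq hN hT hδ]
  linarith

lemma log_inv_le_logFactor {N T : ℕ} {δ : ℝ} (hN : 1 ≤ N) (hT : 1 ≤ T) (hδ : 0 < δ) :
    Real.log (1 / δ) ≤ logFactor N T δ := by
  have h1 : 0 ≤ Real.log (1 + Real.log N) := Real.log_nonneg (by
    linarith [Real.log_nonneg (show (1 : ℝ) ≤ N by exact_mod_cast hN)])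
  have h2 : 0 ≤ Real.log T := Real.log_nonneg (by exact_mod_cast hT)
  rw [logFactor_eq hN hT hδ]
  linarith

lemma log_le_div_four_add {x : ℝ} (hx : 0 < x) : Real.log x ≤ x / 4 + 2 / 5 := by
  have h1 := Real.log_le_sub_one_of_pos (show 0 < x / 4 by positivity)
  have h2 : Real.log x = Real.log (x / 4) + 2 * Real.log 2 := by
    rw [Real.log_div hx.ne' (by norm_num), show (4 : ℝ) = 2 ^ 2 by norm_num, Real.log_pow]
    push_cast; ring
  have := Real.log_two_lt_d9
  linarith

section Parameters

variable {R δ σbar : ℝ} {d N T L : ℕ}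

lemma log_two_mul_div_eq (hN : 1 ≤ N) (hL : 1 ≤ L) (hδ : 0 < δ) :
    Real.log (2 * N * L / δ) = Real.log 2 + Real.log N + Real.log L + Real.log (1 / δ) := by
  have hN0 : (0 : ℝ) < N := by exact_mod_cast hN
  have hL0 : (0 : ℝ) < L := by exact_mod_cast hL
  rw [Real.log_div (by positivity) hδ.ne', Real.log_mul (by positivity) (by positivity),
    Real.log_mul (by norm_num) (by positivity), one_div, Real.log_inv]
  ring

lemma one_le_log_two_mul_div (hN : 2 ≤ N) (hL : 1 ≤ L) (hδ : 0 < δ) (hδ1 : δ < 1) :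
    1 ≤ Real.log (2 * N * L / δ) := by
  have h1 : Real.log 2 ≤ Real.log N := Real.log_le_log (by norm_num) (by exact_mod_cast hN)
  have h2 : 0 ≤ Real.log L := Real.log_nonneg (by exact_mod_cast hL)
  have h3 : 0 ≤ Real.log (1 / δ) := Real.log_nonneg (by rw [le_div_iff₀ hδ]; linarith)
  rw [log_two_mul_div_eq (by omega) hL hδ]
  linarith [Real.log_two_gt_d9]

lemma IsParameterChoice.le_one (h : IsParameterChoice R δ d N T σbar L) (hN : 2 ≤ N) (hL : 1 ≤ L)
    (hT : 1 ≤ T) (hd : 1 ≤ d) (hδ : 0 < δ) (hδ1 : δ < 1) : σbar ≤ 1 := by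
  have h1 := one_le_log_two_mul_div hN hL hδ hδ1
  have h2 : (1 : ℝ) ≤ d := by exact_mod_cast hd
  have h3 : 1 ≤ Real.sqrt T := by
    rw [Real.one_le_sqrt]; exact_mod_cast hT
  rw [h.threshold, div_le_one (by positivity)]
  exact one_le_mul_of_one_le_of_one_le (one_le_mul_of_one_le_of_one_le h2 h1) h3

/-- The number of levels is logarithmic. It occurs in its own bound, through the threshold, but only
by its iterated logarithm. -/
lemma IsParameterChoice.levels_le (h : IsParameterChoice R δ d N T σbar L) (hN : 2 ≤ N)
    (hL : 1 ≤ L) (hR : 0 < R) (hRT : R ≤ T) (hd : 1 ≤ d) (hdT : d ≤ T) (hδ : 0 < δ) (hδ1 : δ < 1)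
    (hlogT : 1 ≤ Real.log T) : L ≤ 13 * logFactor N T δ := by
  have hT : 1 ≤ T := hd.trans hdT
  have hT1 : (1 : ℝ) ≤ T := by exact_mod_cast hT
  have hL1 : (1 : ℝ) ≤ L := by exact_mod_cast hL
  have hdR : (0 : ℝ) < d := by exact_mod_cast hd
  have hdT' : (d : ℝ) ≤ T := by exact_mod_cast hdT
  set ι := Real.log (2 * N * L / δ) with hι
  have hι1 : 1 ≤ ι := one_le_log_two_mul_div hN hL hδ hδ1
  have hlogN : 0 ≤ Real.log N := Real.log_nonneg (by exact_mod_cast (by omega : 1 ≤ N))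
  have hlogL : 0 ≤ Real.log L := Real.log_nonneg hL1
  have hlogδ : 0 ≤ Real.log (1 / δ) := Real.log_nonneg (by rw [le_div_iff₀ hδ]; linarith)
  have hlogι : Real.log ι ≤ logFactor N T δ - Real.log T + Real.log L := by
    have h1 : ι ≤ (1 + Real.log N) * (1 + Real.log (1 / δ)) * (1 + Real.log L) := by
      have h2 := log_two_mul_div_eq (δ := δ) (by omega : 1 ≤ N) hL hδ
      have h3 := Real.log_two_lt_d9
      nlinarith [mul_nonneg hlogN hlogL, mul_nonneg hlogN hlogδ, mul_nonneg hlogL hlogδ,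
        mul_nonneg (mul_nonneg hlogN hlogL) hlogδ]
    have h4 := Real.log_le_log (by linarith) h1
    rw [Real.log_mul (by positivity) (by positivity),
      Real.log_mul (by positivity) (by positivity)] at h4
    have h5 := Real.log_le_sub_one_of_pos (show 0 < 1 + Real.log (1 / δ) by linarith)
    have h6 := Real.log_le_sub_one_of_pos (show 0 < 1 + Real.log L by linarith)
    rw [logFactor_eq (by omega) hT hδ]
    linarith
  have hlog : Real.log (R / σbar) ≤ 3 * Real.log T + Real.log ι := by
    have h1 : R / σbar ≤ T ^ 3 * ι := by
      rw [h.threshold, div_div_eq_mul_div, div_one]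
      have h2 : Real.sqrt T ≤ T := by
        rw [Real.sqrt_le_left (by linarith)]
        nlinarith
      calc R * (d * ι * Real.sqrt T) ≤ T * (T * ι * T) := by gcongr
        _ = T ^ 3 * ι := by ring
    have h3 := Real.log_le_log (div_pos hR h.pos) h1
    rw [Real.log_mul (by positivity) (by positivity), Real.log_pow] at h3
    exact_mod_cast h3
  have hlogb : (L : ℝ) < Real.logb 2 (R / σbar) + 1 := by
    have h1 : 0 < Real.logb 2 (R / σbar) := by
      have : 0 < ⌈Real.logb 2 (R / σbar)⌉₊ := by rw [← h.levels]; omega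
      exact Nat.ceil_pos.1 this
    have h2 := Nat.ceil_lt_add_one h1.le
    rwa [← h.levels] at h2
  have hlogL' := log_le_div_four_add (show (0 : ℝ) < L by linarith)
  have hΛ := log_le_logFactor (δ := δ) (by omega : 1 ≤ N) hT hδ hδ1
  have h2 : Real.logb 2 (R / σbar) ≤ 3 / 2 * (3 * logFactor N T δ + Real.log L) := by
    rw [Real.logb, div_le_iff₀ (Real.log_pos (by norm_num))]
    have h3 : 0 ≤ 3 * logFactor N T δ + Real.log L := by linarith
    nlinarith [Real.log_two_gt_d9]
  linarith

lemma log_two_mul_div_le (hN : 2 ≤ N) (hL : 1 ≤ L) (hT : 1 ≤ T) (hδ : 0 < δ)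
    (hΛ : 1 ≤ logFactor N T δ) (hLΛ : L ≤ 13 * logFactor N T δ) :
    Real.log (2 * N * L / δ) ≤ 23 * logFactor N T δ * Real.log N := by
  have h1 : Real.log 2 ≤ Real.log N := Real.log_le_log (by norm_num) (by exact_mod_cast hN)
  have h2 := log_le_div_four_add (show (0 : ℝ) < L by exact_mod_cast hL)
  have h3 := log_inv_le_logFactor (by omega : 1 ≤ N) hT hδ
  have h4 := Real.log_two_gt_d9
  have h5 := Real.log_two_lt_d9
  rw [log_two_mul_div_eq (by omega) hL hδ]
  nlinarith

lemma log_four_mul_div_le (hN : 2 ≤ N) (hL : 1 ≤ L) (hT : 1 ≤ T) (hδ : 0 < δ) (hδ1 : δ < 1)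
    (hΛ : 1 ≤ logFactor N T δ) (hLΛ : L ≤ 13 * logFactor N T δ) :
    Real.log (4 * T * (T + 1) * L / δ) ≤ (18 * logFactor N T δ) ^ 2 := by
  have hT0 : (1 : ℝ) ≤ T := by exact_mod_cast hT
  have hL0 : (0 : ℝ) < L := by exact_mod_cast hL
  have h1 : Real.log (4 * T * (T + 1) * L / δ) ≤ Real.log (2 ^ 3 * T ^ 2 * L / δ) := by
    refine Real.log_le_log (by positivity) ?_
    have h0 : 4 * (T : ℝ) * (T + 1) ≤ 2 ^ 3 * T ^ 2 := by nlinarith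
    gcongr
  have h2 : Real.log (2 ^ 3 * T ^ 2 * L / δ)
      = 3 * Real.log 2 + 2 * Real.log T + Real.log L + Real.log (1 / δ) := by
    rw [Real.log_div (by positivity) hδ.ne', Real.log_mul (by positivity) (by positivity),
      Real.log_mul (by positivity) (by positivity), Real.log_pow, Real.log_pow, one_div,
      Real.log_inv]
    push_cast; ring
  have h3 := log_le_div_four_add hL0
  have h4 := log_inv_le_logFactor (by omega : 1 ≤ N) hT hδ
  have h5 := log_le_logFactor (by omega : 1 ≤ N) hT hδ hδ1
  have h6 := Real.log_two_lt_d9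
  nlinarith

end Parameters

/-! ### The event on which the regret bound may fail -/

/-- `x` is the leading term. The terms free of the variances are proportional to `d`, and `hd`
compares them to `x`. -/
lemma total_le_leadingTerm {q : ℕ} {d L C Λ x ι logN J S T ρ s : ℝ} (hd1 : 1 ≤ d) (hΛ : 1 ≤ Λ)
    (hT : 1 ≤ T) (hC0 : 0 ≤ C) (hC : C ≤ Λ) (hL : L ≤ 13 * Λ) (hJ : 0 ≤ J)
    (hι1 : 1 ≤ ι) (hι : ι ≤ 23 * Λ * logN) (hx : x = Real.sqrt (d * logN * J))
    (hS : S = 1 / (d * ι) ^ 2) (hρ : ρ = Λ) (hs : s = 18 * Λ) (hd : d ≤ Λ ^ (q + 1) * x) :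
    1 / T + L * (2 * C * d + 4 * Real.sqrt (32 * d * ι * (J + S) + 4 * d * (C + 2 * ρ * s)))
      ≤ 2600 * Λ ^ (q + 3) * x := by
  subst hρ hs
  have hx0 : 0 ≤ x := hx ▸ Real.sqrt_nonneg _
  have hlogN : 0 ≤ logN := by
    by_contra! h
    nlinarith
  have hxx : x ^ 2 = d * logN * J := by rw [hx, Real.sq_sqrt (by positivity)]
  have hX : Real.sqrt (32 * d * ι * (J + S) + 4 * d * (C + 2 * ρ * (18 * ρ)))
      ≤ 28 * ρ * x + 20 * (d * ρ) := by
    refine Real.sqrt_le_iff.2 ⟨by positivity, ?_⟩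
    have h1 : 32 * d * ι * J ≤ 736 * ρ * x ^ 2 := by
      rw [hxx]
      have : d * J * ι ≤ d * J * (23 * ρ * logN) := mul_le_mul_of_nonneg_left hι (by positivity)
      linarith
    have h2 : 32 * d * ι * S ≤ 32 := by
      rw [hS, mul_one_div, div_le_iff₀ (by positivity)]
      have : 1 ≤ d * ι := one_le_mul_of_one_le_of_one_le hd1 hι1
      nlinarith
    have h3 : C ≤ ρ ^ 2 := by nlinarith
    have h4 : d * C ≤ d * ρ ^ 2 := mul_le_mul_of_nonneg_left h3 (by linarith)
    have h5 : d * ρ ^ 2 ≤ (d * ρ) ^ 2 := by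
      rw [mul_pow]
      exact mul_le_mul_of_nonneg_right (by nlinarith) (sq_nonneg ρ)
    have h6 : 1 ≤ (d * ρ) ^ 2 := one_le_pow₀ (one_le_mul_of_one_le_of_one_le hd1 hΛ)
    have h7 : ρ * x ^ 2 ≤ (ρ * x) ^ 2 := by
      rw [mul_pow]
      exact mul_le_mul_of_nonneg_right (by nlinarith) (sq_nonneg x)
    have h8 : 0 ≤ (ρ * x) * (d * ρ) := by positivity
    nlinarith
  have hinner : 2 * C * d
      + 4 * Real.sqrt (32 * d * ι * (J + S) + 4 * d * (C + 2 * ρ * (18 * ρ)))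
      ≤ 112 * (ρ * x) + 82 * (d * ρ) := by nlinarith
  have hT' : 1 / T ≤ d * ρ ^ 2 := by
    have h1 : 1 / T ≤ 1 := by rw [div_le_one (by linarith)]; exact hT
    have h2 : 1 ≤ d * ρ ^ 2 := one_le_mul_of_one_le_of_one_le hd1 (one_le_pow₀ hΛ)
    linarith
  have houter : L * (2 * C * d
      + 4 * Real.sqrt (32 * d * ι * (J + S) + 4 * d * (C + 2 * ρ * (18 * ρ))))
      ≤ 13 * ρ * (112 * (ρ * x) + 82 * (d * ρ)) :=
    mul_le_mul hL hinner (by positivity) (by positivity)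
  have h1 : ρ ^ 2 * d ≤ ρ ^ 2 * (ρ ^ (q + 1) * x) := mul_le_mul_of_nonneg_left hd (sq_nonneg ρ)
  have h2 : ρ ^ 2 * (ρ ^ (q + 1) * x) = ρ ^ (q + 3) * x := by ring
  have h3 : ρ ^ 2 * x ≤ ρ ^ (q + 3) * x :=
    mul_le_mul_of_nonneg_right (pow_le_pow_right₀ hΛ (by omega)) hx0
  have h4 : 0 ≤ ρ ^ (q + 3) * x := by positivity
  linarith

/-- If `T` is below the leading term up to logarithms, the trivial bound `2 * C * T` on the regret
suffices. -/
lemma trivial_le_leadingTerm {q : ℕ} {C κ ℓ Λ x T r : ℝ} (hx : 0 ≤ x) (hℓ : 1 ≤ ℓ) (hℓΛ : ℓ ≤ Λ)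
    (hκ : 2 * C * κ ≤ ℓ) (hr : r ≤ 2 * C * T)
    (hT : 0 < C → T ≤ Λ ^ 2 * (κ * ℓ ^ q * x)) (hT0 : 0 ≤ T) : r ≤ 2600 * Λ ^ (q + 3) * x := by
  have hΛ : 0 < Λ := by linarith
  rcases le_or_gt C 0 with hC | hC
  · have h1 : 0 ≤ 2600 * Λ ^ (q + 3) * x := by positivity
    nlinarith
  · calc r ≤ 2 * C * T := hr
      _ ≤ 2 * C * (Λ ^ 2 * (κ * ℓ ^ q * x)) := mul_le_mul_of_nonneg_left (hT hC) (by positivity)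
      _ = (2 * C * κ) * (Λ ^ 2 * ℓ ^ q * x) := by ring
      _ ≤ Λ * (Λ ^ 2 * Λ ^ q * x) := by
          have : 0 ≤ Λ ^ 2 * ℓ ^ q * x := by positivity
          calc (2 * C * κ) * (Λ ^ 2 * ℓ ^ q * x) ≤ Λ * (Λ ^ 2 * ℓ ^ q * x) :=
                mul_le_mul_of_nonneg_right (hκ.trans hℓΛ) this
            _ ≤ _ := by gcongr
      _ = 1 * Λ ^ (q + 3) * x := by ring
      _ ≤ 2600 * Λ ^ (q + 3) * x := by gcongr; norm_num

/-- The bound on the probability that a sample is not good. The factor `exp (1 / 2)` comes from the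
sharper deviation inequality and uses up part of the gap between `δ / 2` and `δ`. -/
lemma failure_probability_le {δ M : ℝ} {N L T : ℕ} (hδ : 0 < δ) (hN : 1 ≤ N) (hL : 1 ≤ L)
    (hT : 1 ≤ T) (hM : M ^ 2 = 2 * Real.log (16 * T / δ)) :
    N * L * Real.exp (-(Real.log (2 * N * L / δ) - 1 / 2)) + 2 * T * Real.exp (-(M ^ 2 / 2))
      ≤ δ := by
  have hN0 : (0 : ℝ) < N := by exact_mod_cast hN
  have hL0 : (0 : ℝ) < L := by exact_mod_cast hL
  have hT0 : (0 : ℝ) < T := by exact_mod_cast hT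
  have h1 : Real.exp (-(Real.log (2 * N * L / δ) - 1 / 2))
      = Real.exp (1 / 2) * (δ / (2 * N * L)) := by
    rw [neg_sub, sub_eq_add_neg, Real.exp_add, Real.exp_neg, Real.exp_log (by positivity), inv_div]
  have h2 : Real.exp (-(M ^ 2 / 2)) = δ / (16 * T) := by
    rw [hM, mul_div_cancel_left₀ _ two_ne_zero, Real.exp_neg, Real.exp_log (by positivity), inv_div]
  have h3 : Real.exp (1 / 2) ≤ 165 / 100 := by
    have h4 : Real.exp (1 / 2) ^ 2 = Real.exp 1 := by
      rw [← Real.exp_nat_mul]; norm_num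
    have h5 := Real.exp_one_lt_d9
    nlinarith [Real.exp_pos (1 / 2)]
  have h6 : (N : ℝ) * L * (Real.exp (1 / 2) * (δ / (2 * N * L))) = Real.exp (1 / 2) * δ / 2 := by
    field_simp
  have h7 : 2 * (T : ℝ) * (δ / (16 * T)) = δ / 8 := by
    field_simp; norm_num
  rw [h1, h2, h6, h7]
  nlinarith

lemma exists_horizon (C R κ : ℝ) : ∃ T₀ : ℕ, ∀ T : ℕ, T₀ ≤ T →
    1 ≤ Real.log T ∧ R ≤ Real.log T ∧ κ ≤ Real.log T ∧ C ≤ Real.log T ∧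
      2 * C * κ ≤ Real.log T ∧ (0 < C → 1 ≤ C * T ∧ 128 ^ 2 ≤ C ^ 2 * T) := by
  have hcast := tendsto_natCast_atTop_atTop (R := ℝ)
  have hlog := Real.tendsto_log_atTop.comp hcast
  have hmul : ∀ b : ℝ, 0 < b → Filter.Tendsto (fun T : ℕ => b * (T : ℝ)) Filter.atTop
      Filter.atTop := fun b hb => hcast.const_mul_atTop hb
  have hlast : ∀ᶠ T : ℕ in Filter.atTop, 0 < C → 1 ≤ C * T ∧ 128 ^ 2 ≤ C ^ 2 * (T : ℝ) := by
    rcases le_or_gt C 0 with hC | hC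
    · exact Filter.Eventually.of_forall fun T h => absurd h (not_lt.2 hC)
    · filter_upwards [(hmul C hC).eventually_ge_atTop 1,
        (hmul (C ^ 2) (by positivity)).eventually_ge_atTop (128 ^ 2)] with T h1 h2 _
      exact ⟨h1, h2⟩
  have hall := (hlog.eventually_ge_atTop 1).and ((hlog.eventually_ge_atTop R).and
    ((hlog.eventually_ge_atTop κ).and ((hlog.eventually_ge_atTop C).and
      ((hlog.eventually_ge_atTop (2 * C * κ)).and hlast))))
  exact Filter.eventually_atTop.1 hall

end HeteroBandit

end

open HeteroBandit in
theorem corollary1 (q : ℕ) :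
    ∃ (K : ℝ) (p : ℕ), 0 < K ∧
      ∀ C R κ : ℝ, 0 < R → 0 < κ → ∃ T₀ : ℕ, ∀ T : ℕ, T₀ ≤ T → ∀ δ : ℝ, 0 < δ → δ < 1 →
      -- the function class and the reward function
      ∀ (A : Type*) [MeasurableSpace A] (F : Set (A → ℝ)) (fstar : A → ℝ),
        (∀ f ∈ F, Measurable f) → fstar ∈ F → (∀ x, |fstar x| ≤ C) →
      ∀ d N : ℕ, HeteroBandit.eluderDim F (1 / (T : ℝ) ^ 2) = d → 1 ≤ d →
        HeteroBandit.supCoveringNumber F (1 / (T : NNReal) ^ 2) = N →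
      -- the parameters of the algorithm
      ∀ (σbar : ℝ) (L : ℕ), HeteroBandit.IsParameterChoice R δ d N T σbar L →
      -- the environment, the noise and the run of the algorithm
      ∀ (Ω : Type*) (mΩ : MeasurableSpace Ω) (μ : MeasureTheory.Measure Ω)
        [MeasureTheory.IsProbabilityMeasure μ] (ℱ : MeasureTheory.Filtration ℕ mΩ)
        (D : ℕ → Ω → Set A) (σ ε : ℕ → Ω → ℝ) (a : ℕ → Ω → A) (lev : ℕ → Ω → ℕ)
        (fhat : ℕ → ℕ → Ω → A → ℝ),
        HeteroBandit.IsSubGaussianBandit μ ℱ T R a lev σ ε →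
        (∀ ω, HeteroBandit.IsML2Path F T L σbar
          (HeteroBandit.radius C δ (1 / (T : ℝ) ^ 2) σbar N L)
          (fun t => D t ω) (fun t => σ t ω) (fun t => fstar (a t ω) + ε t ω)
          (fun t => a t ω) (fun t => lev t ω) (fun t l => fhat t l ω)) →
      μ {ω | ¬ (min (d : ℝ) T ≤ κ * Real.log T ^ q *
              HeteroBandit.leadingTerm d N (HeteroBandit.totalVar (fun t => σ t ω) T) →
            HeteroBandit.regret fstar (fun t => D t ω) (fun t => a t ω) T ≤
              K * HeteroBandit.logFactor N T δ ^ p *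
                HeteroBandit.leadingTerm d N (HeteroBandit.totalVar (fun t => σ t ω) T))}
        ≤ ENNReal.ofReal δ := by
  refine ⟨2600, q + 3, by norm_num, fun C R κ hR hκ => ?_⟩
  obtain ⟨T₀, hT₀⟩ := exists_horizon C R κ
  refine ⟨T₀, fun T hTT₀ δ hδ hδ1 A _ F fstar hF hstar hbdd d N hd hd1 hN σbar L hpar Ω mΩ μ _ ℱ
    D σ ε a lev fhat hband hpath => ?_⟩
  obtain ⟨hlog1, hRlog, hκlog, hClog, hCκ, hClarge⟩ := hT₀ T hTT₀
  have hT : 1 ≤ T := by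
    rcases Nat.eq_zero_or_pos T with rfl | h
    · norm_num at hlog1
    · exact h
  have hTR : (1 : ℝ) ≤ T := by exact_mod_cast hT
  have hdR : (1 : ℝ) ≤ d := by exact_mod_cast hd1
  have h1T : 1 ∈ Finset.Icc 1 T := Finset.mem_Icc.2 ⟨le_rfl, hT⟩
  obtain ⟨G, hGcard, hGF, hcov⟩ := exists_finset_cover hN
  have hα : ((1 / (T : ℝ≥0) ^ 2 : ℝ≥0) : ℝ) = 1 / (T : ℝ) ^ 2 := by push_cast; rfl
  rw [hα] at hcov
  have hN1 : 1 ≤ N := by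
    obtain ⟨g, hg, -⟩ := hcov fstar hstar
    rw [← hGcard]
    exact Finset.card_pos.2 ⟨g, hg⟩
  obtain ⟨ω₀⟩ := nonempty_of_isProbabilityMeasure μ
  have hL : 1 ≤ L := Nat.one_le_of_lt ((hpath ω₀).level_lt 1 h1T)
  have hℓΛ : Real.log T ≤ logFactor N T δ := log_le_logFactor hN1 hT hδ hδ1
  have hΛ1 : 1 ≤ logFactor N T δ := hlog1.trans hℓΛ
  by_cases hmain : 2 ≤ N ∧ 0 < C ∧ d < T ∧ logFactor N T δ ^ 2 < T
  · obtain ⟨hN2, hC, hdT, hΛT⟩ := hmain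
    have hLΛ := hpar.levels_le hN2 hL hR
      (hRlog.trans (Real.log_le_self (by linarith))) hd1 hdT.le hδ hδ1 hlog1
    have hι1 := one_le_log_two_mul_div hN2 hL hδ hδ1
    set M : ℝ := Real.sqrt (2 * Real.log (16 * T / δ)) with hMdef
    have h16 : 1 ≤ 16 * T / δ := by
      rw [le_div_iff₀ hδ]
      linarith
    have hM : M ^ 2 = 2 * Real.log (16 * T / δ) :=
      Real.sq_sqrt (mul_nonneg zero_le_two (Real.log_nonneg h16))
    have hMT : 16 * M ^ 2 ≤ C * T := by
      have h1 : Real.log (16 * T / δ) = 4 * Real.log 2 + Real.log T + Real.log (1 / δ) := by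
        rw [Real.log_div (by positivity) hδ.ne', Real.log_mul (by norm_num) (by positivity),
          show (16 : ℝ) = 2 ^ 4 by norm_num, Real.log_pow, one_div, Real.log_inv]
        push_cast; ring
      have h2 : Real.log T + Real.log (1 / δ) ≤ logFactor N T δ := by
        rw [logFactor_eq hN1 hT hδ]
        have : 0 ≤ Real.log (1 + Real.log N) := Real.log_nonneg (by
          linarith [Real.log_nonneg (show (1 : ℝ) ≤ N by exact_mod_cast hN1)])
        linarith
      have h3 : 128 * logFactor N T δ ≤ C * T := by
        refine le_of_sq_le_sq ?_ (by positivity)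
        calc (128 * logFactor N T δ) ^ 2 = 128 ^ 2 * logFactor N T δ ^ 2 := by ring
          _ ≤ (C ^ 2 * T) * T := mul_le_mul (hClarge hC).2 hΛT.le (sq_nonneg _) (by positivity)
          _ = (C * T) ^ 2 := by ring
      have h4 := Real.log_two_lt_d9
      rw [hM, h1]
      linarith
    refine (measure_mono fun ω hω => ?_).trans
      ((hband.measure_not_good_le hpar.pos (fun t ht ω =>
        (le_max_right _ _).trans ((hpath ω).level_upper t ht)) (fun g hg => hF g (hGF g hg))
        (hF fstar hstar) L (Real.log (2 * N * L / δ) - 1 / 2) (Real.sqrt_nonneg _ : 0 ≤ M)).trans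
        (ENNReal.ofReal_le_ofReal (?_ : _ ≤ δ)))
    swap
    · rw [hGcard]
      exact failure_probability_le hδ hN1 hL hT hM
    refine fun hgood => hω fun hmin => ?_
    have hconf : ∀ t ∈ Finset.Icc 1 T, ∀ l < L, fstar ∈ confSet F (fun t => a t ω)
        (levelData (fun t => lev t ω) t l) (fhat t l ω)
        (radius C δ (1 / (T : ℝ) ^ 2) σbar N L t l) := fun t ht l hl =>
      mem_confSet_of_isGoodSample hstar hpar.pos hcov hC (hClarge hC).1 hMT hgood ht hl
        ((hpath ω).erm t ht l hl)
    have hreg := (hpath ω).regret_le hstar hbdd hC.le hpar.pos hδ hL hT (by linarith)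
      (by positivity) (log_four_mul_div_le hN2 hL hT hδ hδ1 hΛ1 hLΛ)
      (fun t ht => max_le ((hpar.le_one hN2 hL hT hd1 hδ hδ1).trans hΛ1)
        ((hband.sigma_lt t ht ω).le.trans (hRlog.trans hℓΛ))) (by positivity) hconf hd
    have hx0 : 0 ≤ leadingTerm d N (totalVar (fun t => σ t ω) T) := Real.sqrt_nonneg _
    refine hreg.trans (total_le_leadingTerm hdR hΛ1 hTR hC.le (hClog.trans hℓΛ)
      hLΛ (Finset.sum_nonneg fun _ _ => sq_nonneg _) hι1
      (log_two_mul_div_le hN2 hL hT hδ hΛ1 hLΛ) rfl ?_ rfl rfl ?_)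
    · rw [hpar.threshold, div_pow, mul_pow _ (Real.sqrt T), Real.sq_sqrt (by linarith)]
      field_simp
    · rw [min_eq_left (by exact_mod_cast hdT.le)] at hmin
      refine hmin.trans (mul_le_mul_of_nonneg_right ?_ hx0)
      calc κ * Real.log T ^ q ≤ logFactor N T δ * logFactor N T δ ^ q := by
            have := hκlog.trans hℓΛ
            gcongr
        _ = logFactor N T δ ^ (q + 1) := by ring
  -- In the remaining cases the bound holds on every sample path.
  · have hempty : {ω | ¬ (min (d : ℝ) T ≤ κ * Real.log T ^ q *
              leadingTerm d N (totalVar (fun t => σ t ω) T) →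
            regret fstar (fun t => D t ω) (fun t => a t ω) T ≤ 2600 * logFactor N T δ ^ (q + 3) *
                leadingTerm d N (totalVar (fun t => σ t ω) T))} = ∅ := by
      refine Set.eq_empty_iff_forall_notMem.2 fun ω hω => hω fun hmin => ?_
      have hx0 : 0 ≤ leadingTerm d N (totalVar (fun t => σ t ω) T) := Real.sqrt_nonneg _
      refine trivial_le_leadingTerm hx0 hlog1 hℓΛ hCκ
        (regret_le_two_mul hbdd (hpath ω).action_mem) (fun hC => ?_) (by linarith)
      have hmin1 : 1 ≤ κ * Real.log T ^ q * leadingTerm d N (totalVar (fun t => σ t ω) T) :=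
        (le_min hdR hTR).trans hmin
      have hN2 : 2 ≤ N := by
        by_contra hN2
        have hN' : N = 1 := by omega
        rw [leadingTerm, hN'] at hmin1
        norm_num at hmin1
      rcases lt_or_ge d T with hdT | hdT
      · have hΛT : (T : ℝ) ≤ logFactor N T δ ^ 2 := by
          by_contra! h
          exact hmain ⟨hN2, hC, hdT, h⟩
        nlinarith [sq_nonneg (logFactor N T δ)]
      · rw [min_eq_right (by exact_mod_cast hdT)] at hmin
        nlinarith [one_le_pow₀ hΛ1 (n := 2)]
    rw [hempty, measure_empty]
    exact zero_le
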